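/- **Model.** Time is slotted, $t=0,1,2,\dots$. There are $N\ge 1$ users; user $j$ has a binary sequence $s_j$ of period $L$ and a starting offset $\tau_j\in\{0,\dots,L-1\}$. User $j$ starts at slot $\tau_j$ and transmits in slot $t\ge\tau_j$ iff $s_j(t-\tau_j)=1$. A transmission is successful iff no other user transmits in the same slot. User $j$ generates a packet at the beginning of each of its frames, i.e. at the slots $\tau_j+nT$, $n\ge 0$, and the packet expires at the end of the frame. The age of information $A_{\tau}(t)$ of user $i$ equals $t-g$ if user $i$ transmits successfully in slot $t$, where $g$ is the generation time of its current packet, and $A_\tau(t-1)+1$ otherwise (with an arbitrary initial value). Put $\overline{A_\tau}=\lim_{\lambda\to\infty}\frac1\lambda\sum_{t=0}^{\lambda}A_\tau(t)$ and $\overline A=L^{-N}\sum_{\tau}\overline{A_\tau}$, the sum being over all offset vectors $\tau\in\{0,\dots,L-1\}^N$. The sequences form an *MHUI set* if each has at least $N$ ones per period (Hamming weight $\ge N$) and $\sum_{t=0}^{L-1}s_i(t)s_j(t+\tau)\le 1$ for all $i\ne j$ and all $\tau\in\{0,\dots,L-1\}$. Let $x_0<\dots<x_{w-1}$ be the positions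 of the ones of $s_i$ in one period, $\ell_k=x_{k+1}-x_k$ for $k<w-1$, $\ell_{w-1}=x_0+L-x_{w-1}$, and $\zeta_w(k,j)=\sum_{m=0}^{j-1}\ell_{(k+m)\bmod w}$. For a positive integer $d$ put $f=d-\lfloor d/T\rfloor T-1$ and $$F_1(d)=\frac{\lceil d/T\rceil f(f+1)+\lfloor d/T\rfloor (f+T)(T-f-1)+\big(\lfloor d/T\rfloor(2d-T)-\lfloor d/T\rfloor^2T+d\big)T}{2L}-\frac{d}{2L},$$ $$P_r=\frac1{L^{N-1}}\sum_{n=w-r}^{N-1}\sum_{m=0}^{w-r}(-1)^m\binom{N-1}{n}\binom{w-r}{m}(w-r-m)^n\,w^n\,(L-w^2)^{N-1-n}\qquad(0^0=1).$$ **Theorem.** (a) Let $s_1,\dots,s_N$ be an MHUI set of period $L$ in which all sequences have the same Hamming weight $w$, and let $T\ge1$ with $\gcd(T,L)=1$. Then for every user $i$: for each $r\in\{1,\dots,w\}$ and each set $E$ of $r$ ones of $s_i$ (within one period), $P_r$ is the probability, over uniform offsets, that $E$ is exactly the set of successful ones of user $i$ when all users are active; the limits $\overline{A_\tau}$ exist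 and do not depend on the initial value; and $$\overline A=P_1\,w\,F_1(L)+\sum_{r=2}^{w}P_r\sum_{j=1}^{w}\frac{(w-j-1)!\,\sum_{k=0}^{w-1}F_1(\zeta_w(k,j))}{(r-2)!\,(w-j-r+1)!},$$ where the terms with $j>w-r+1$ are read as $0$. (b) This applies to the CRT construction: let $p$ be the smallest prime with $p\ge N$, let $q\ge 2p-1$ be coprime to $p$, and $L=pq$. For $1\le g\le p$ let $v_g(t)=1$ iff $t\equiv ug\pmod p$ and $t\equiv u\pmod q$ for some $u\in\{0,\dots,p-1\}$, and let $v_{p+1}(t)=1$ iff $q\mid t$. Any $N$ distinct sequences among $v_1,\dots,v_{p+1}$ form an MHUI set of period $L$ with all Hamming weights equal to $w=p$. (c) Given $N,L,w,T$ and $\ell_0,\dots,\ell_{w-1}$, with $1\le N\le w$, the right-hand side in (a) can be evaluated by one fixed program (rational arithmetic, floor, ceiling, and bounded sum and product loops, each elementary operation and each loop iteration counting as one step) in $O(w^4)$ steps; this is $O(N^4)$ steps under the CRT construction ($w=p$). -/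

import Mathlib

open Filter Topology

/-! ## Sequence sets

A binary sequence of period `L` is a function `ℕ → Bool` that is periodic with period `L`. -/

/-- The characteristic set of a sequence: the positions of the `1`s within one period. -/
def ones (L : ℕ) (s : ℕ → Bool) : Finset ℕ :=
  (Finset.range L).filter fun t => s t = true

/-- The Hamming weight of a sequence. -/
def hammingWt (L : ℕ) (s : ℕ → Bool) : ℕ := (ones L s).card

/-- Hamming cross-correlation of two sequences of period `L` at relative offset `τ`. -/
def crossCorr (L : ℕ) (s s' : ℕ → Bool) (τ : ℕ) : ℕ :=
  ∑ t ∈ Finset.range L, (s t).toNat * (s' (t + τ)).toNat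

/-- Minimum Hamming user-irrepressible sequence sets of `N` sequences of period `L`. -/
structure IsMHUI (N L : ℕ) (s : Fin N → ℕ → Bool) : Prop where
  periodic : ∀ i, Function.Periodic (s i) L
  le_weight : ∀ i, N ≤ hammingWt L (s i)
  crossCorr_le : ∀ i j, i ≠ j → ∀ τ < L, crossCorr L (s i) (s j) τ ≤ 1

/-- The `g`-th sequence (`1 ≤ g ≤ p + 1`) of the CRT construction with parameters `p`, `q`. -/
def crtSeq (p q g : ℕ) (t : ℕ) : Bool :=
  if g ≤ p then decide (∃ u < p, t % p = (u * g) % p ∧ t % q = u % q)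
  else decide (∃ u < p, t % p = u % p ∧ t % q = 0)

/-- `p` is the smallest prime that is at least `N`. -/
def IsLeastPrimeGE (N p : ℕ) : Prop := IsLeast {p : ℕ | p.Prime ∧ N ≤ p} p

/-! ## Channel and age of information

User `j` starts its session at the reference time `τ j`: its local clock at the reference time
`t ≥ τ j` is `t - τ j`, and its frames are the blocks of `T` slots of its local clock. -/

/-- User `j` transmits in slot `t`. -/
def transmits {N L : ℕ} (s : Fin N → ℕ → Bool) (τ : Fin N → Fin L) (j : Fin N) (t : ℕ) : Bool :=
  decide ((τ j : ℕ) ≤ t) && s j (t - τ j)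

/-- The transmission of user `i` in slot `t` is successful: user `i` is the only transmitter. -/
def delivers {N L : ℕ} (s : Fin N → ℕ → Bool) (τ : Fin N → Fin L) (i : Fin N) (t : ℕ) : Bool :=
  decide (transmits s τ i t = true ∧ ∀ j, j ≠ i → transmits s τ j t = false)

/-- The generation time of the packet that user `i` holds in slot `t ≥ τ i`: the start of the
current frame of user `i`. -/
def genTime {N L : ℕ} (T : ℕ) (τ : Fin N → Fin L) (i : Fin N) (t : ℕ) : ℕ :=
  τ i + T * ((t - τ i) / T)

/-- The instantaneous AoI of user `i`; `a₀` is its value in slot `0` if nothing is delivered then.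
For a repeated delivery of the same packet both branches give the same value, so only the first
delivery of a packet makes the AoI drop. -/
def aoi {N L : ℕ} (T : ℕ) (s : Fin N → ℕ → Bool) (τ : Fin N → Fin L) (i : Fin N) (a₀ : ℕ) : ℕ → ℕ
  | 0 => if delivers s τ i 0 = true then 0 - genTime T τ i 0 else a₀
  | t + 1 =>
    if delivers s τ i (t + 1) = true then t + 1 - genTime T τ i (t + 1)
    else aoi T s τ i a₀ t + 1

/-- `a` is the long-run average AoI of user `i` under the offset vector `τ`. -/
def IsAverageAoI {N L : ℕ} (T : ℕ) (s : Fin N → ℕ → Bool) (τ : Fin N → Fin L) (i : Fin N)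
    (a₀ : ℕ) (a : ℝ) : Prop :=
  Tendsto (fun n : ℕ => (1 / (n : ℝ)) * ∑ t ∈ Finset.range (n + 1), (aoi T s τ i a₀ t : ℝ))
    atTop (𝓝 a)

/-- The set of successful `1`s of user `i` (as local positions within one sequence period) when all
users are active; at the local time `x` of user `i` the local time of user `j` is
`x + τ i - τ j` modulo `L`. -/
def successfulOnes {N L : ℕ} (s : Fin N → ℕ → Bool) (τ : Fin N → Fin L) (i : Fin N) : Finset ℕ :=
  (ones L (s i)).filter fun x => ∀ j, j ≠ i → s j (x + τ i + (L - τ j)) = false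

/-- The probability, over uniformly distributed offset vectors, that the set of successful `1`s of
user `i` is exactly `E`. -/
def eventProb {N : ℕ} (L : ℕ) (s : Fin N → ℕ → Bool) (i : Fin N) (E : Finset ℕ) : ℚ :=
  ((Finset.univ.filter fun τ : Fin N → Fin L => successfulOnes s τ i = E).card : ℚ) / (L : ℚ) ^ N

/-! ## The closed form -/

/-- The cyclic distance `ℓ_k` between the `k`-th and the next `1` in a sequence of period `L` and
Hamming weight `w` (`k < w`, counting from `0`). -/
noncomputable def gap (L w : ℕ) (s : ℕ → Bool) (k : ℕ) : ℕ :=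
  if k + 1 < w then
    Nat.nth (fun t => s t = true) (k + 1) - Nat.nth (fun t => s t = true) k
  else
    Nat.nth (fun t => s t = true) 0 + L - Nat.nth (fun t => s t = true) k

/-- `ζ_w(k, j)`, the sum of `j` cyclically consecutive distances starting with `ℓ_k`. -/
def zeta (w : ℕ) (l : ℕ → ℕ) (k j : ℕ) : ℕ :=
  ∑ i ∈ Finset.range j, l ((k + i) % w)

/-- `P_r`. -/
def probP (N L w r : ℕ) : ℚ :=
  1 / (L : ℚ) ^ (N - 1) *
    ∑ n ∈ Finset.Icc (w - r) (N - 1), ∑ m ∈ Finset.range (w - r + 1),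
      (-1 : ℚ) ^ m * ((N - 1).choose n : ℚ) * ((w - r).choose m : ℚ) * ((w : ℚ) - r - m) ^ n *
        (w : ℚ) ^ n * ((L : ℚ) - (w : ℚ) ^ 2) ^ (N - 1 - n)

/-- `f(d) = d - ⌊d/T⌋ T - 1`. -/
def residF (T d : ℕ) : ℚ := (d : ℚ) - ⌊(d : ℚ) / T⌋ * T - 1

/-- `F₁(d)`. -/
def F1 (L T d : ℕ) : ℚ :=
  ((⌈(d : ℚ) / T⌉ : ℚ) * (residF T d * (residF T d + 1)) +
      (⌊(d : ℚ) / T⌋ : ℚ) * ((residF T d + T) * (T - residF T d - 1)) +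
      ((⌊(d : ℚ) / T⌋ : ℚ) * (2 * d - T) - (⌊(d : ℚ) / T⌋ : ℚ) ^ 2 * T + d) * T) / (2 * L)
    - (d : ℚ) / (2 * L)

/-- The closed form. The inner sum runs over those `j` for which the factorials have nonnegative
arguments; the other terms vanish by convention. -/
def closedForm (N L w T : ℕ) (l : ℕ → ℕ) : ℚ :=
  probP N L w 1 * w * F1 L T L +
    ∑ r ∈ Finset.Icc 2 w, probP N L w r *
      ∑ j ∈ Finset.Icc 1 (w + 1 - r),
        ((w - j - 1).factorial * ∑ k ∈ Finset.range w, F1 L T (zeta w l k j)) /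
          ((r - 2).factorial * (w - j - (r - 1)).factorial)

/-! ## Arithmetic programs and their operation count -/

/-- Programs made of rational arithmetic, reading of an input array, and bounded loops that
accumulate a sum or a product. Variables are numbered. -/
inductive Prog : Type
  | lit (c : ℤ)
  | var (x : ℕ)
  | get (e : Prog)
  | add (a b : Prog)
  | sub (a b : Prog)
  | mul (a b : Prog)
  | div (a b : Prog)
  | floor (a : Prog)
  | ceil (a : Prog)
  | sum (x : ℕ) (n body : Prog)
  | prod (x : ℕ) (n body : Prog)

/-- The value of a program, for an assignment `v` of the variables and an input array `l`. A loop
`sum x n body` runs `body` with `x = 0, 1, …, n - 1` and adds up the values. -/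
def Prog.eval (l : ℕ → ℕ) : Prog → (ℕ → ℚ) → ℚ
  | .lit c, _ => c
  | .var x, v => v x
  | .get e, v => l ⌊e.eval l v⌋₊
  | .add a b, v => a.eval l v + b.eval l v
  | .sub a b, v => a.eval l v - b.eval l v
  | .mul a b, v => a.eval l v * b.eval l v
  | .div a b, v => a.eval l v / b.eval l v
  | .floor a, v => ⌊a.eval l v⌋
  | .ceil a, v => ⌈a.eval l v⌉
  | .sum x n b, v => ∑ t ∈ Finset.range ⌊n.eval l v⌋₊, b.eval l (Function.update v x t)
  | .prod x n b, v => ∏ t ∈ Finset.range ⌊n.eval l v⌋₊, b.eval l (Function.update v x t)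

/-- The number of elementary steps of an evaluation: every literal, variable or array access, every
arithmetic operation, every loop and every loop iteration costs one step. -/
def Prog.cost (l : ℕ → ℕ) : Prog → (ℕ → ℚ) → ℕ
  | .lit _, _ => 1
  | .var _, _ => 1
  | .get e, v => e.cost l v + 1
  | .add a b, v => a.cost l v + b.cost l v + 1
  | .sub a b, v => a.cost l v + b.cost l v + 1
  | .mul a b, v => a.cost l v + b.cost l v + 1
  | .div a b, v => a.cost l v + b.cost l v + 1
  | .floor a, v => a.cost l v + 1
  | .ceil a, v => a.cost l v + 1
  | .sum x n b, v => n.cost l v + 1 +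
      ∑ t ∈ Finset.range ⌊n.eval l v⌋₊, (b.cost l (Function.update v x t) + 1)
  | .prod x n b, v => n.cost l v + 1 +
      ∑ t ∈ Finset.range ⌊n.eval l v⌋₊, (b.cost l (Function.update v x t) + 1)

/-- The scalar inputs `N`, `L`, `w`, `T` are in the variables `0`, `1`, `2`, `3`. -/
def inputs (N L w T : ℕ) : ℕ → ℚ
  | 0 => N
  | 1 => L
  | 2 => w
  | 3 => T
  | _ => 0

/-! ### Distribution of the set of successful ones -/

/-! Law of the successful set. Correlation at most 1 lets each interferer block at most one 1 of
user `i` per period. With the offset of user `i` fixed, a given 1 is hit for exactly `w` of the `L`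
offsets of an interferer, and distinct 1s are hit at disjoint sets of offsets. Hence an interferer
blocks only inside a set `C` for `L - w (w - |C|)` offsets, independently of the others, and
inclusion-exclusion gives the probability that exactly `E` survives (`card_successfulOnes_eq`). The
binomial theorem turns this into `P_r`; the powers missing there vanish as high finite differences
of low-degree monomials (`probP_eq`).

Average for a given `E`. Weight at least `N` against `N - 1` interferers leaves `E` nonempty, so the
age is eventually the delay since the last success plus the frame phase of that success. As `gcd(T,
L) = 1`, a stretch of `L * T` slots meets every pair (sequence phase, frame phase) once; the frame
phase averages to `(T - 1) / 2`, and the time average depends on `E` only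
(`isAverageAoI_averageAge`).

Averaging over `E`. `F1 d` equals `d (d + T - 2) / (2 L)`, the total of `slotAge` over `u < d`. For
a 1 at `y` and a delay `u` whose window after `y` holds `j` ones, `(w - 1 - j).choose (r - 1)` of
the `r`-sets contain `y` and avoid the window. Summation by parts in `j` with Pascal's rule yields
the factorials of the closed form.

The CRT claim is a uniqueness argument modulo `q` and then modulo `p`. The complexity claim exhibits
a program; Bertrand's postulate gives `p ≤ 2 N`. -/

lemma mem_ones {L : ℕ} {s : ℕ → Bool} {x : ℕ} : x ∈ ones L s ↔ x < L ∧ s x = true := by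
  simp [ones]

lemma crossCorr_eq_card (L : ℕ) (s s' : ℕ → Bool) (τ : ℕ) :
    crossCorr L s s' τ = ((ones L s).filter fun x => s' (x + τ) = true).card := by
  rw [crossCorr, ones, Finset.filter_filter, Finset.card_filter]
  refine Finset.sum_congr rfl fun t _ => ?_
  cases s t <;> cases s' (t + τ) <;> simp

/-- The ones of `s` that collide with `s'` when the local clocks have offsets `a` and `c`. -/
def blockedOnes (L : ℕ) (s s' : ℕ → Bool) (a c : ℕ) : Finset ℕ :=
  (ones L s).filter fun x => s' (x + a + (L - c)) = true

/-- By periodicity only the clock difference modulo `L` matters, and this is one of the offsets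
bounded by `crossCorr_le`. -/
lemma card_blockedOnes_le_one {N L : ℕ} {s : Fin N → ℕ → Bool} (h : IsMHUI N L s) (hL : 0 < L)
    {i j : Fin N} (hij : i ≠ j) (a c : ℕ) : (blockedOnes L (s i) (s j) a c).card ≤ 1 := by
  have h1 := h.crossCorr_le i j hij ((a + (L - c)) % L) (Nat.mod_lt _ hL)
  rw [crossCorr_eq_card] at h1
  rw [blockedOnes]
  convert h1 using 2
  refine Finset.filter_congr fun x _ => ?_
  rw [← (h.periodic j).map_mod_nat (x + (a + (L - c)) % L),
    ← (h.periodic j).map_mod_nat (x + a + (L - c)), Nat.add_mod_mod, add_assoc]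

/-- The map `c ↦ b - c` modulo `L`, written without negative numbers, is an involution; it serves as
its own inverse in the next bijection. -/
lemma reflect_reflect {L b c : ℕ} (hc : c < L) :
    (b + (L - (b + (L - c)) % L)) % L = c := by
  have hL : 0 < L := by omega
  have h1 := Nat.mod_lt (b + (L - c)) hL
  have h2 := Nat.div_add_mod (b + (L - c)) L
  generalize (b + (L - c)) % L = m at *
  generalize (b + (L - c)) / L = q at *
  have h3 : b + (L - m) = c + L * q := by omega
  rw [h3, Nat.add_mul_mod_self_left, Nat.mod_eq_of_lt hc]

lemma card_offsets_eq_hammingWt {L : ℕ} {s : ℕ → Bool} (hs : Function.Periodic s L) (hL : 0 < L)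
    (b : ℕ) :
    (Finset.univ.filter fun c : Fin L => s (b + (L - c)) = true).card = hammingWt L s := by
  refine Finset.card_bij' (fun c _ => (b + (L - c)) % L)
    (fun y _ => ⟨(b + (L - y)) % L, Nat.mod_lt _ hL⟩) ?_ ?_ ?_ ?_
  · intro c hc
    rw [mem_ones, hs.map_mod_nat]
    exact ⟨Nat.mod_lt _ hL, by simpa using hc⟩
  · intro y hy
    rw [mem_ones] at hy
    simp only [Finset.mem_filter, Finset.mem_univ, true_and]
    rw [← hs.map_mod_nat, reflect_reflect hy.1]
    exact hy.2
  · intro c _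
    exact Fin.ext (reflect_reflect c.2)
  · intro y hy
    exact reflect_reflect (mem_ones.1 hy).1

/-- The complementary event is the union, over the `w - |C|` ones outside `C`, of the `w` offsets
hitting that one. The union is disjoint since no offset blocks two ones. -/
lemma card_offsets_blockedOnes_subset {N L w : ℕ} {s : Fin N → ℕ → Bool} (h : IsMHUI N L s)
    (hw : ∀ j, hammingWt L (s j) = w) (hL : 0 < L) {i j : Fin N} (hij : i ≠ j) (a : ℕ)
    {C : Finset ℕ} (hC : C ⊆ ones L (s i)) :
    ((Finset.univ.filter fun c : Fin L => blockedOnes L (s i) (s j) a c ⊆ C).card : ℚ)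
      = L - w * (w - C.card) := by
  classical
  have h1 := Finset.card_filter_add_card_filter_not (s := (Finset.univ : Finset (Fin L)))
    (fun c : Fin L => blockedOnes L (s i) (s j) a c ⊆ C)
  have h2 : (Finset.univ.filter fun c : Fin L => ¬ blockedOnes L (s i) (s j) a c ⊆ C)
      = (ones L (s i) \ C).biUnion
        fun x => Finset.univ.filter fun c : Fin L => s j (x + a + (L - c)) = true := by
    ext c
    simp only [Finset.mem_filter, Finset.mem_univ, true_and, Finset.mem_biUnion,
      Finset.mem_sdiff, Finset.not_subset, blockedOnes]
    constructor
    · rintro ⟨x, ⟨h1, h2⟩, h3⟩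
      exact ⟨x, ⟨h1, h3⟩, h2⟩
    · rintro ⟨x, ⟨h1, h3⟩, h2⟩
      exact ⟨x, ⟨h1, h2⟩, h3⟩
  rw [h2, Finset.card_biUnion, Finset.sum_congr rfl fun x _ =>
    card_offsets_eq_hammingWt (h.periodic j) hL (x + a), Finset.sum_const, hw,
    Finset.card_sdiff_of_subset hC, show (ones L (s i)).card = w from hw i] at h1
  · have h3 : C.card ≤ w := by
      rw [← hw i]; exact Finset.card_le_card hC
    have h4 := congrArg (Nat.cast : ℕ → ℚ) h1
    push_cast [Nat.cast_sub h3] at h4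
    simp only [Finset.card_univ, Fintype.card_fin, smul_eq_mul] at h4
    push_cast [Nat.cast_sub h3] at h4
    linarith
  · intro x hx y hy hxy
    rw [Function.onFun, Finset.disjoint_left]
    intro c hc hc'
    simp only [Finset.mem_filter, Finset.mem_univ, true_and] at hc hc'
    have := Finset.card_le_one.1 (card_blockedOnes_le_one h hL hij a c)
    rw [Finset.mem_coe, Finset.mem_sdiff] at hx hy
    exact hxy (this x (Finset.mem_filter.2 ⟨hx.1, hc⟩) y (Finset.mem_filter.2 ⟨hy.1, hc'⟩))

/-- Once `τ i` is fixed, the conditions on the other coordinates are independent, so each fibre is a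
product set. -/
lemma card_offsets_all_blockedOnes_subset {N L w : ℕ} {s : Fin N → ℕ → Bool} (h : IsMHUI N L s)
    (hw : ∀ j, hammingWt L (s j) = w) (hL : 0 < L) (i : Fin N)
    {C : Finset ℕ} (hC : C ⊆ ones L (s i)) :
    ((Finset.univ.filter fun τ : Fin N → Fin L =>
      ∀ j, j ≠ i → blockedOnes L (s i) (s j) (τ i) (τ j) ⊆ C).card : ℚ)
      = L * (L - w * (w - C.card)) ^ (N - 1) := by
  classical
  rw [Finset.card_eq_sum_card_fiberwise (f := fun τ : Fin N → Fin L => τ i)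
    (t := Finset.univ) (fun _ _ => Finset.mem_coe.2 (Finset.mem_univ _))]
  have key : ∀ a : Fin L, (((Finset.univ.filter fun τ : Fin N → Fin L =>
      ∀ j, j ≠ i → blockedOnes L (s i) (s j) (τ i) (τ j) ⊆ C).filter
        fun τ => τ i = a).card : ℚ) = (L - w * (w - C.card)) ^ (N - 1) := by
    intro a
    have : (Finset.univ.filter fun τ : Fin N → Fin L =>
      ∀ j, j ≠ i → blockedOnes L (s i) (s j) (τ i) (τ j) ⊆ C).filter (fun τ => τ i = a)
      = Fintype.piFinset fun j => if j = i then {a} else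
          Finset.univ.filter fun c : Fin L => blockedOnes L (s i) (s j) a c ⊆ C := by
      ext τ
      simp only [Finset.mem_filter, Finset.mem_univ, true_and, Fintype.mem_piFinset]
      constructor
      · rintro ⟨h1, h2⟩ j
        by_cases hj : j = i
        · subst hj; simpa using h2
        · simpa [hj, ← h2] using h1 j hj
      · intro h1
        have h2 : τ i = a := by simpa using h1 i
        exact ⟨fun j hj => by simpa [hj, h2] using h1 j, h2⟩
    rw [this, Fintype.card_piFinset, Nat.cast_prod,
      ← Finset.mul_prod_erase _ _ (Finset.mem_univ i)]
    rw [Finset.prod_congr rfl (g := fun _ => (L - w * (w - C.card) : ℚ))]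
    · simp
    · intro j hj
      have hj := Finset.ne_of_mem_erase hj
      rw [if_neg hj]
      exact card_offsets_blockedOnes_subset h hw hL (Ne.symm hj) a hC
  rw [Nat.cast_sum, Finset.sum_congr rfl fun a _ => key a]
  simp

lemma sdiff_successfulOnes_subset_iff {N L : ℕ} (s : Fin N → ℕ → Bool) (τ : Fin N → Fin L)
    (i : Fin N) (C : Finset ℕ) :
    ones L (s i) \ successfulOnes s τ i ⊆ C ↔
      ∀ j, j ≠ i → blockedOnes L (s i) (s j) (τ i) (τ j) ⊆ C := by
  simp only [Finset.subset_iff, blockedOnes, successfulOnes, Finset.mem_sdiff, Finset.mem_filter]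
  constructor
  · rintro h j hj x ⟨h1, h2⟩
    refine h ⟨h1, fun h3 => ?_⟩
    simp [h3.2 j hj] at h2
  · rintro h x ⟨h1, h2⟩
    simp only [not_and, not_forall, Bool.not_eq_false] at h2
    obtain ⟨j, hj, h3⟩ := h2 h1
    exact h j hj ⟨h1, h3⟩

lemma successfulOnes_subset {N L : ℕ} (s : Fin N → ℕ → Bool) (τ : Fin N → Fin L) (i : Fin N) :
    successfulOnes s τ i ⊆ ones L (s i) := Finset.filter_subset _ _

/-- The `N - 1` interferers block at most one 1 each, and there are at least `N`. -/
lemma successfulOnes_nonempty {N L : ℕ} {s : Fin N → ℕ → Bool} (h : IsMHUI N L s) (hL : 0 < L)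
    (τ : Fin N → Fin L) (i : Fin N) : (successfulOnes s τ i).Nonempty := by
  classical
  rw [← Finset.card_pos]
  have h1 : ones L (s i) \ successfulOnes s τ i ⊆ (Finset.univ.erase i).biUnion
      fun j => blockedOnes L (s i) (s j) (τ i) (τ j) := by
    rw [sdiff_successfulOnes_subset_iff]
    intro j hj x hx
    exact Finset.mem_biUnion.2 ⟨j, by simp [hj], hx⟩
  have h2 := (Finset.card_le_card h1).trans (Finset.card_biUnion_le_card_mul _ _ 1
    fun j hj => card_blockedOnes_le_one h hL (Finset.ne_of_mem_erase hj).symm _ _)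
  rw [Finset.card_sdiff_of_subset (successfulOnes_subset s τ i)] at h2
  have h3 : N ≤ (ones L (s i)).card := h.le_weight i
  have h4 : 0 < N := i.pos
  simp at h2
  omega

lemma card_successfulOnes_eq {N L w : ℕ} {s : Fin N → ℕ → Bool} (h : IsMHUI N L s)
    (hw : ∀ j, hammingWt L (s j) = w) (hL : 0 < L) (i : Fin N)
    {E : Finset ℕ} (hE : E ⊆ ones L (s i)) :
    ((Finset.univ.filter fun τ : Fin N → Fin L => successfulOnes s τ i = E).card : ℚ)
      = L * ∑ m ∈ Finset.range (w - E.card + 1), (-1) ^ m * ((w - E.card).choose m : ℚ) *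
        (w * (w - E.card - m) + (L - w ^ 2)) ^ (N - 1) := by
  classical
  set B := ones L (s i) \ E with hB
  have hBc : B.card = w - E.card := by
    rw [hB, Finset.card_sdiff_of_subset hE, ← hw i]; rfl
  have hEw : E.card ≤ w := by rw [← hw i]; exact Finset.card_le_card hE
  -- Inclusion-exclusion for one `τ`: with `U` the blocked ones, the surviving `S` are the subsets
  -- of `B \ U`, whose signed count is 1 if `B \ U` is empty and 0 otherwise.
  have ind : ∀ τ : Fin N → Fin L, (if successfulOnes s τ i = E then (1 : ℚ) else 0)
      = ∑ S ∈ B.powerset, (-1) ^ S.card *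
        (if ∀ j, j ≠ i → blockedOnes L (s i) (s j) (τ i) (τ j) ⊆ B \ S then (1 : ℚ) else 0) := by
    intro τ
    set U := ones L (s i) \ successfulOnes s τ i with hU
    have hUE : successfulOnes s τ i = E ↔ U = B := by
      constructor
      · intro h; rw [hU, hB, h]
      · intro h
        rw [← Finset.sdiff_sdiff_eq_self (successfulOnes_subset s τ i), ← hU, h, hB,
          Finset.sdiff_sdiff_eq_self hE]
    simp only [← sdiff_successfulOnes_subset_iff, ← hU, hUE, mul_ite, mul_one, mul_zero]
    rw [← Finset.sum_filter]
    by_cases hsub : U ⊆ B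
    · have : B.powerset.filter (fun S => U ⊆ B \ S) = (B \ U).powerset := by
        ext S
        simp only [Finset.mem_filter, Finset.mem_powerset, Finset.subset_sdiff]
        constructor
        · rintro ⟨h1, h2, h3⟩; exact ⟨h1, h3.symm⟩
        · rintro ⟨h1, h2⟩; exact ⟨h1, hsub, h2.symm⟩
      rw [this]
      have hUB : U = B ↔ B \ U = ∅ := by
        rw [Finset.sdiff_eq_empty_iff_subset]
        exact ⟨fun h => h ▸ subset_rfl, fun h => hsub.antisymm h⟩
      have h5 := Finset.sum_powerset_neg_one_pow_card (x := B \ U)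
      have h6 : (∑ S ∈ (B \ U).powerset, (-1 : ℚ) ^ S.card)
          = if B \ U = ∅ then 1 else 0 := by exact_mod_cast congrArg (Int.cast : ℤ → ℚ) h5
      rw [h6]
      exact if_congr hUB rfl rfl
    · rw [if_neg fun h : U = B => hsub (h ▸ subset_rfl), Finset.filter_false_of_mem, Finset.sum_empty]
      exact fun S _ hS => hsub (hS.trans Finset.sdiff_subset)
  rw [Finset.card_filter, Nat.cast_sum]
  push_cast
  rw [Finset.sum_congr rfl fun τ _ => ind τ, Finset.sum_comm]
  have : ∀ S ∈ B.powerset, ∑ τ : Fin N → Fin L, (-1 : ℚ) ^ S.card *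
        (if ∀ j, j ≠ i → blockedOnes L (s i) (s j) (τ i) (τ j) ⊆ B \ S then (1 : ℚ) else 0)
      = (fun m : ℕ => (-1) ^ m * (L * (L - w * (E.card + m)) ^ (N - 1) : ℚ)) S.card := by
    intro S hS
    rw [Finset.mem_powerset] at hS
    rw [← Finset.mul_sum]
    have h7 := card_offsets_all_blockedOnes_subset h hw hL i
      (C := B \ S) (Finset.sdiff_subset.trans Finset.sdiff_subset)
    rw [Finset.card_filter, Nat.cast_sum] at h7
    push_cast at h7
    rw [h7, Finset.card_sdiff_of_subset hS, hBc, Nat.cast_sub (hBc ▸ Finset.card_le_card hS),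
      Nat.cast_sub hEw]
    ring
  rw [Finset.sum_congr rfl this, Finset.sum_powerset_apply_card
    (fun m : ℕ => (-1) ^ m * (L * (L - w * (E.card + m)) ^ (N - 1) : ℚ)), hBc, Finset.mul_sum]
  refine Finset.sum_congr rfl fun m _ => ?_
  -- This splitting of the base is the one that the binomial theorem expands in `probP_eq`.
  rw [nsmul_eq_mul, show (L - w * (E.card + m) : ℚ) = w * (w - E.card - m) + (L - w ^ 2) by ring]
  ring

/-- Up to the reversal `m ↦ K - m`, this is the `K`-th finite difference of a monomial of degree
below `K`. -/
lemma alternating_sum_choose_mul_pow_eq_zero {n K : ℕ} (h : n < K) (x : ℚ) :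
    ∑ m ∈ Finset.range (K + 1), (-1) ^ m * (K.choose m : ℚ) * (x - m) ^ n = 0 := by
  have h1 := fwdDiff_iter_eq_sum_shift (1 : ℚ) (fun r : ℚ => r ^ n) K (x - K)
  rw [fwdDiff_iter_pow_eq_zero_of_lt h, Pi.zero_apply, ← Finset.sum_range_reflect] at h1
  rw [h1]
  refine Finset.sum_congr rfl fun m hm => ?_
  have hm : m ≤ K := by simpa [Nat.lt_succ_iff] using hm
  rw [show K + 1 - 1 - m = K - m by omega, Nat.choose_symm hm, show K - (K - m) = m by omega]
  simp only [zsmul_eq_mul, nsmul_eq_mul, mul_one, Nat.cast_sub hm]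
  push_cast
  ring

/-- Expanding the power produces all exponents `n ≤ N - 1`; those with `n < w - r` cancel in the
alternating sum over `m`, which is why `P_r` omits them. -/
lemma probP_eq {N L w r : ℕ} (hr : r ≤ w) :
    probP N L w r = 1 / (L : ℚ) ^ (N - 1) *
      ∑ m ∈ Finset.range (w - r + 1), (-1) ^ m * ((w - r).choose m : ℚ) *
        (w * (w - r - m) + (L - w ^ 2)) ^ (N - 1) := by
  rw [probP]
  congr 1
  have h1 : ∀ m : ℕ, (-1 : ℚ) ^ m * ((w - r).choose m : ℚ) *
        (w * (w - r - m) + (L - w ^ 2)) ^ (N - 1) = ∑ n ∈ Finset.range (N - 1 + 1),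
        (-1 : ℚ) ^ m * ((N - 1).choose n : ℚ) * ((w - r).choose m : ℚ) * ((w : ℚ) - r - m) ^ n *
        (w : ℚ) ^ n * ((L : ℚ) - (w : ℚ) ^ 2) ^ (N - 1 - n) := by
    intro m
    rw [add_pow, Finset.mul_sum]
    refine Finset.sum_congr rfl fun n _ => ?_
    rw [mul_pow]; ring
  rw [Finset.sum_congr rfl fun m _ => h1 m]
  symm
  rw [Finset.sum_comm]
  symm
  refine Finset.sum_subset (fun n hn => ?_) fun n hn hn' => ?_
  · simp only [Finset.mem_Icc, Finset.mem_range] at hn ⊢; omega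
  · have hlt : n < w - r := by
      simp only [Finset.mem_Icc, Finset.mem_range] at hn hn'; omega
    have h2 := alternating_sum_choose_mul_pow_eq_zero hlt ((w : ℚ) - r)
    calc _ = ((N - 1).choose n : ℚ) * (w : ℚ) ^ n * ((L : ℚ) - (w : ℚ) ^ 2) ^ (N - 1 - n) *
          ∑ m ∈ Finset.range (w - r + 1), (-1) ^ m * ((w - r).choose m : ℚ) *
            ((w : ℚ) - r - m) ^ n := by
          rw [Finset.mul_sum]; exact Finset.sum_congr rfl fun m _ => by ring
      _ = 0 := by rw [h2, mul_zero]

lemma eventProb_eq_probP {N L w : ℕ} {s : Fin N → ℕ → Bool} (h : IsMHUI N L s)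
    (hw : ∀ j, hammingWt L (s j) = w) (hL : 0 < L) (i : Fin N)
    {E : Finset ℕ} (hE : E ⊆ ones L (s i)) : eventProb L s i E = probP N L w E.card := by
  have hEw : E.card ≤ w := by rw [← hw i]; exact Finset.card_le_card hE
  rw [eventProb, card_successfulOnes_eq h hw hL i hE, probP_eq hEw]
  have hN : (L : ℚ) ^ N = L * L ^ (N - 1) := by rw [← pow_succ', Nat.sub_add_cancel i.pos]
  have : (L : ℚ) ≠ 0 := by positivity
  rw [hN]
  field_simp

/-! ### The CRT construction -/

lemma crtSeq_of_le {p q g t : ℕ} (h : g ≤ p) :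
    crtSeq p q g t = true ↔ ∃ u < p, t ≡ u * g [MOD p] ∧ t ≡ u [MOD q] := by
  simp [crtSeq, h, Nat.ModEq]

lemma crtSeq_of_gt {p q g t : ℕ} (h : p < g) (hp : 0 < p) :
    crtSeq p q g t = true ↔ t ≡ 0 [MOD q] := by
  simp only [crtSeq, not_le.2 h, if_false, decide_eq_true_eq, Nat.ModEq, Nat.zero_mod]
  constructor
  · rintro ⟨_, _, _, h⟩; exact h
  · exact fun h => ⟨t % p, Nat.mod_lt _ hp, by simp, h⟩

lemma crtSeq_periodic (p q g : ℕ) : Function.Periodic (crtSeq p q g) (p * q) := by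
  intro t
  simp [crtSeq, Nat.add_mod]

lemma Nat.ModEq.eq_of_lt_of_coprime {p q t t' : ℕ} (hpq : Nat.Coprime p q)
    (h : t < p * q) (h' : t' < p * q) (h1 : t ≡ t' [MOD p]) (h2 : t ≡ t' [MOD q]) : t = t' :=
  Nat.ModEq.eq_of_lt_of_lt ((Nat.modEq_and_modEq_iff_modEq_mul hpq).1 ⟨h1, h2⟩) h h'

/-- For `g ≤ p` the ones correspond to the parameters `u < p` by the Chinese remainder theorem; as
`p ≤ q`, the residue modulo `q` recovers `u`. For `g > p` they are the multiples of `q`. -/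
lemma hammingWt_crtSeq {p q g : ℕ} (hp : 0 < p) (hpq : Nat.Coprime p q) (hq : p ≤ q) :
    hammingWt (p * q) (crtSeq p q g) = p := by
  have hq0 : 0 < q := by omega
  rw [hammingWt]
  by_cases hg : g ≤ p
  · have hlt : ∀ u, (Nat.chineseRemainder hpq (u * g) u : ℕ) < p * q := fun u =>
      Nat.chineseRemainder_lt_mul hpq _ _ (by omega) (by omega)
    have hc : (Finset.range p).card = (ones (p * q) (crtSeq p q g)).card := by
      refine Finset.card_bij (fun u _ => (Nat.chineseRemainder hpq (u * g) u : ℕ)) ?_ ?_ ?_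
      · intro u hu
        rw [mem_ones, crtSeq_of_le hg]
        exact ⟨hlt u, u, Finset.mem_range.1 hu, (Nat.chineseRemainder hpq (u * g) u).2⟩
      · intro u hu v hv huv
        have h1 := (Nat.chineseRemainder hpq (u * g) u).2.2
        have h2 := (Nat.chineseRemainder hpq (v * g) v).2.2
        rw [huv] at h1
        rw [Finset.mem_range] at hu hv
        exact Nat.ModEq.eq_of_lt_of_lt (h1.symm.trans h2) (by omega) (by omega)
      · intro t ht
        rw [mem_ones, crtSeq_of_le hg] at ht
        obtain ⟨ht, u, hu, h1, h2⟩ := ht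
        have h3 := (Nat.chineseRemainder hpq (u * g) u).2
        exact ⟨u, Finset.mem_range.2 hu, Nat.ModEq.eq_of_lt_of_coprime hpq (hlt u) ht
          (h3.1.trans h1.symm) (h3.2.trans h2.symm)⟩
    rw [← hc, Finset.card_range]
  · have hc : (Finset.range p).card = (ones (p * q) (crtSeq p q g)).card := by
      refine Finset.card_bij (fun u _ => u * q) ?_ ?_ ?_
      · intro u hu
        rw [Finset.mem_range] at hu
        rw [mem_ones, crtSeq_of_gt (not_le.1 hg) hp]
        exact ⟨Nat.mul_lt_mul_of_pos_right hu hq0, by simp [Nat.ModEq]⟩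
      · intro u _ v _ huv
        exact Nat.eq_of_mul_eq_mul_right hq0 huv
      · intro t ht
        rw [mem_ones, crtSeq_of_gt (not_le.1 hg) hp, Nat.modEq_zero_iff_dvd] at ht
        obtain ⟨ht, u, rfl⟩ := ht
        refine ⟨u, ?_, mul_comm _ _⟩
        rw [mul_comm q u] at ht
        exact Finset.mem_range.2 (Nat.lt_of_mul_lt_mul_right ht)
    rw [← hc, Finset.card_range]

/-- It suffices that both collisions have the same parameter `u` or `x`. If one sequence is the last
one, then `t ≡ t'` modulo `q` gives this at once. Otherwise the residues modulo `q` fix the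
difference of the two parameters, and those modulo `p` then fix the parameters. -/
lemma crtSeq_collision_unique {p q g h : ℕ} (hp : p.Prime) (hpq : Nat.Coprime p q)
    (hq : 2 * p - 1 ≤ q) (hg : g ∈ Finset.Icc 1 (p + 1)) (hh : h ∈ Finset.Icc 1 (p + 1))
    (hgh : g ≠ h) {τ t t' : ℕ} (ht : t < p * q) (ht' : t' < p * q)
    (h1 : crtSeq p q g t = true) (h2 : crtSeq p q h (t + τ) = true)
    (h1' : crtSeq p q g t' = true) (h2' : crtSeq p q h (t' + τ) = true) : t = t' := by
  have hp0 := hp.pos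
  have hp2 := hp.two_le
  rw [Finset.mem_Icc] at hg hh
  refine Nat.ModEq.eq_of_lt_of_coprime hpq ht ht' ?_ ?_
  all_goals
    by_cases hgp : g ≤ p
    · rw [crtSeq_of_le hgp] at h1 h1'
      obtain ⟨u, hu, ha, hb⟩ := h1
      obtain ⟨u', hu', ha', hb'⟩ := h1'
      by_cases hhp : h ≤ p
      · rw [crtSeq_of_le hhp] at h2 h2'
        obtain ⟨x, hx, hc, hd⟩ := h2
        obtain ⟨x', hx', hc', hd'⟩ := h2'
        -- Both sides are at most `2 p - 2 < q`, so the congruence modulo `q` is an equality; this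
        -- is the use of `q ≥ 2 p - 1`.
        have e1 : x + u' = x' + u := by
          have : x + u' ≡ x' + u [MOD q] := by
            have e' := (hd'.symm.trans (hb'.add_right τ)).add (Nat.ModEq.refl u)
            have e'' := (hd.symm.trans (hb.add_right τ)).add (Nat.ModEq.refl u')
            refine e''.trans (Nat.ModEq.trans ?_ e'.symm)
            rw [show u + τ + u' = u' + τ + u by ring]
          exact Nat.ModEq.eq_of_lt_of_lt this (by omega) (by omega)
        have e2 : u = u' := by
          have e : x * h + u' * g ≡ x' * h + u * g [MOD p] := by
            have e' := (hc.symm.trans (ha.add_right τ)).add (Nat.ModEq.refl (u' * g))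
            have e'' := (hc'.symm.trans (ha'.add_right τ)).add (Nat.ModEq.refl (u * g))
            refine e'.trans (Nat.ModEq.trans ?_ e''.symm)
            rw [show u * g + τ + u' * g = u' * g + τ + u * g by ring]
          have e3 : (p : ℤ) ∣ ((u : ℤ) - u') * ((h : ℤ) - g) := by
            have := (Nat.modEq_iff_dvd.1 e.symm)
            push_cast at this
            have e1' : (x : ℤ) = x' + u - u' := by omega
            rw [e1'] at this
            convert this using 1; ring
          rcases (Nat.prime_iff_prime_int.1 hp).dvd_or_dvd e3 with e4 | e4
          · have := Int.eq_zero_of_abs_lt_dvd e4 (by rw [abs_lt]; omega)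
            omega
          · have := Int.eq_zero_of_abs_lt_dvd e4 (by rw [abs_lt]; omega)
            omega
        subst e2
        first | exact ha.trans ha'.symm | exact hb.trans hb'.symm
      · rw [crtSeq_of_gt (not_le.1 hhp) hp0] at h2 h2'
        have e1 : t ≡ t' [MOD q] := Nat.ModEq.add_right_cancel' τ (h2.trans h2'.symm)
        have e2 : u = u' := Nat.ModEq.eq_of_lt_of_lt (hb.symm.trans (e1.trans hb'))
          (by omega) (by omega)
        subst e2
        first | exact ha.trans ha'.symm | exact hb.trans hb'.symm
    · rw [crtSeq_of_gt (not_le.1 hgp) hp0] at h1 h1'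
      have hhp : h ≤ p := by omega
      rw [crtSeq_of_le hhp] at h2 h2'
      obtain ⟨x, hx, hc, hd⟩ := h2
      obtain ⟨x', hx', hc', hd'⟩ := h2'
      have e1 : t ≡ t' [MOD q] := h1.trans h1'.symm
      have e2 : x = x' := Nat.ModEq.eq_of_lt_of_lt
        (hd.symm.trans ((e1.add_right τ).trans hd')) (by omega) (by omega)
      subst e2
      first
        | exact e1
        | exact Nat.ModEq.add_right_cancel' τ (hc.trans hc'.symm)

lemma isMHUI_crtSeq {N p q : ℕ} {g : Fin N → ℕ} (hp : IsLeastPrimeGE N p)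
    (hpq : Nat.Coprime q p) (hq : 2 * p - 1 ≤ q) (hinj : Function.Injective g)
    (hg : ∀ j, g j ∈ Finset.Icc 1 (p + 1)) :
    IsMHUI N (p * q) (fun j => crtSeq p q (g j)) ∧
      ∀ j, hammingWt (p * q) (crtSeq p q (g j)) = p := by
  obtain ⟨hp1, hp2⟩ := hp.1
  have hw : ∀ j, hammingWt (p * q) (crtSeq p q (g j)) = p := fun j =>
    hammingWt_crtSeq hp1.pos hpq.symm (by have := hp1.pos; omega)
  refine ⟨⟨fun i => crtSeq_periodic _ _ _, fun i => (hw i).symm ▸ hp2, fun i j hij τ _ => ?_⟩, hw⟩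
  rw [crossCorr_eq_card, Finset.card_le_one]
  intro t ht t' ht'
  rw [Finset.mem_filter, mem_ones] at ht ht'
  exact crtSeq_collision_unique hp1 hpq.symm hq (hg i) (hg j) (fun h => hij (hinj h))
    ht.1.1 ht'.1.1 ht.1.2 ht.2 ht'.1.2 ht'.2

/-! ### A program for the closed form -/

namespace Prog

lemma cost_sum_le (l : ℕ → ℕ) (x : ℕ) (n b : Prog) (v : ℕ → ℚ) {K B : ℕ}
    (hK : ⌊n.eval l v⌋₊ ≤ K) (hB : ∀ t < ⌊n.eval l v⌋₊, b.cost l (Function.update v x t) ≤ B) :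
    (Prog.sum x n b).cost l v ≤ n.cost l v + 1 + K * (B + 1) := by
  rw [Prog.cost]
  refine Nat.add_le_add_left ?_ _
  refine (Finset.sum_le_card_nsmul _ _ (B + 1) fun t ht => ?_).trans ?_
  · exact Nat.succ_le_succ (hB t (Finset.mem_range.1 ht))
  · rw [Finset.card_range, smul_eq_mul]; exact Nat.mul_le_mul_right _ hK

lemma cost_prod_le (l : ℕ → ℕ) (x : ℕ) (n b : Prog) (v : ℕ → ℚ) {K B : ℕ}
    (hK : ⌊n.eval l v⌋₊ ≤ K) (hB : ∀ t < ⌊n.eval l v⌋₊, b.cost l (Function.update v x t) ≤ B) :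
    (Prog.prod x n b).cost l v ≤ n.cost l v + 1 + K * (B + 1) :=
  cost_sum_le l x n b v hK hB

/-- Factorial of `e`, with loop variable `7`. -/
def fact (e : Prog) : Prog := prod 7 e (add (var 7) (lit 1))

/-- The power `b ^ e`, with loop variable `7`. -/
def power (b e : Prog) : Prog := prod 7 e b

/-- The binomial coefficient `a` over `b`, with loop variable `7`. -/
def binom (a b : Prog) : Prog := prod 7 b (div (sub a (var 7)) (add (var 7) (lit 1)))

lemma eval_fact {l : ℕ → ℕ} {e : Prog} {v : ℕ → ℚ} {n : ℕ} (he : e.eval l v = n) :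
    (fact e).eval l v = n.factorial := by
  simp [fact, Prog.eval, he, ← Finset.prod_range_add_one_eq_factorial]

lemma cost_fact_le {l : ℕ → ℕ} {e : Prog} {v : ℕ → ℚ} {n : ℕ} (he : e.eval l v = n) :
    (fact e).cost l v ≤ e.cost l v + 1 + n * 4 := by
  simp [fact, Prog.cost, he]

/-- The base sits in the loop body and is evaluated with variable 7 overwritten, hence the
quantifier over `t`. -/
lemma eval_power {l : ℕ → ℕ} {b e : Prog} {v : ℕ → ℚ} {n : ℕ} {x : ℚ} (he : e.eval l v = n)
    (hb : ∀ t : ℚ, b.eval l (Function.update v 7 t) = x) : (power b e).eval l v = x ^ n := by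
  simp [power, Prog.eval, he, hb]

lemma cost_power_le {l : ℕ → ℕ} {b e : Prog} {v : ℕ → ℚ} {n B : ℕ} (he : e.eval l v = n)
    (hb : ∀ t : ℚ, b.cost l (Function.update v 7 t) ≤ B) :
    (power b e).cost l v ≤ e.cost l v + 1 + n * (B + 1) :=
  cost_prod_le l 7 e b v (by simp [he]) fun t _ => hb t

/-- Also valid for `k > n`: the factor with loop value `n` vanishes. -/
lemma eval_binom {l : ℕ → ℕ} {a b : Prog} {v : ℕ → ℚ} {n k : ℕ} (hb : b.eval l v = k)
    (ha : ∀ t : ℚ, a.eval l (Function.update v 7 t) = n) :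
    (binom a b).eval l v = n.choose k := by
  simp only [binom, Prog.eval, hb, ha, Nat.floor_natCast, Function.update_self]
  clear hb
  induction k with
  | zero => simp
  | succ k ih =>
    rw [Finset.prod_range_succ, ih]
    have h := Nat.choose_succ_right_eq n k
    have h' : ((n.choose (k + 1) : ℕ) : ℚ) * (k + 1) = n.choose k * (n - k) := by
      rcases le_or_gt k n with hk | hk
      · rw [← Nat.cast_sub hk]; exact_mod_cast h
      · rw [Nat.choose_eq_zero_of_lt hk, Nat.choose_eq_zero_of_lt (by omega)]; simp
    have : (k : ℚ) + 1 ≠ 0 := by positivity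
    field_simp
    push_cast
    linarith

lemma cost_binom_le {l : ℕ → ℕ} {a b : Prog} {v : ℕ → ℚ} {k B : ℕ} (hb : b.eval l v = k)
    (ha : ∀ t : ℚ, a.cost l (Function.update v 7 t) ≤ B) :
    (binom a b).cost l v ≤ b.cost l v + 1 + k * (B + 7) := by
  refine (cost_prod_le l 7 _ _ v (K := k) (B := B + 6) (by simp [hb]) fun t _ => ?_)
  have := ha t
  simp only [Prog.cost]
  omega

/-- `f(d)`. -/
def residProg (d : Prog) : Prog :=
  sub (sub d (mul (floor (div d (var 3))) (var 3))) (lit 1)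

/-- `F₁(d)`. -/
def F1Prog (d : Prog) : Prog :=
  sub (div (add (add
    (mul (ceil (div d (var 3))) (mul (residProg d) (add (residProg d) (lit 1))))
    (mul (floor (div d (var 3))) (mul (add (residProg d) (var 3))
      (sub (sub (var 3) (residProg d)) (lit 1)))))
    (mul (add (sub (mul (floor (div d (var 3))) (sub (mul (lit 2) d) (var 3)))
      (mul (mul (floor (div d (var 3))) (floor (div d (var 3)))) (var 3))) d) (var 3)))
    (mul (lit 2) (var 1))) (div d (mul (lit 2) (var 1)))

lemma eval_F1Prog {l : ℕ → ℕ} {d : Prog} {v : ℕ → ℚ} {L T n : ℕ} (hL : v 1 = L) (hT : v 3 = T)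
    (hd : d.eval l v = n) : (F1Prog d).eval l v = F1 L T n := by
  simp only [F1Prog, residProg, Prog.eval, hL, hT, hd, F1, residF]
  push_cast
  ring

lemma cost_F1Prog {l : ℕ → ℕ} {d : Prog} {v : ℕ → ℚ} :
    (F1Prog d).cost l v ≤ 100 * d.cost l v + 200 := by
  simp only [F1Prog, residProg, Prog.cost]
  omega

/-- `ζ_w(k, j)` for `k` in the variable `6` and `j - 1` in the variable `5`. -/
def zetaProg : Prog :=
  sum 7 (add (var 5) (lit 1)) (get (sub (add (var 6) (var 7))
    (mul (var 2) (floor (div (add (var 6) (var 7)) (var 2))))))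

lemma eval_zetaProg {l : ℕ → ℕ} {v : ℕ → ℚ} {w j k : ℕ} (h2 : v 2 = w) (h5 : v 5 = j)
    (h6 : v 6 = k) : zetaProg.eval l v = zeta w l k (j + 1) := by
  have hj : ⌊(j : ℚ) + (1 : ℤ)⌋₊ = j + 1 := by exact_mod_cast Nat.floor_natCast (j + 1)
  simp only [zetaProg, Prog.eval, h5, hj, zeta, Nat.cast_sum]
  refine Finset.sum_congr rfl fun t _ => ?_
  -- The remainder modulo `w` is recovered from the floor of the quotient.
  have h : (k : ℚ) + t - w * (⌊((k : ℚ) + t) / w⌋ : ℤ) = ((k + t) % w : ℕ) := by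
    have h1 : ⌊((k : ℚ) + t) / w⌋ = (((k + t) / w : ℕ) : ℤ) := by
      have := Rat.floor_natCast_div_natCast (k + t) w
      push_cast at this ⊢
      exact this
    have h2 : ((w * ((k + t) / w) + (k + t) % w : ℕ) : ℚ) = (k + t : ℕ) := by
      rw [Nat.div_add_mod]
    rw [h1, Int.cast_natCast]
    rw [Nat.cast_add, Nat.cast_mul, Nat.cast_add] at h2
    linarith
  simp [h2, h6, h]

lemma cost_zetaProg {l : ℕ → ℕ} {v : ℕ → ℚ} {j : ℕ} (h5 : v 5 = j) :
    zetaProg.cost l v ≤ 4 + (j + 1) * 14 := by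
  have hj : ⌊(j : ℚ) + (1 : ℤ)⌋₊ = j + 1 := by exact_mod_cast Nat.floor_natCast (j + 1)
  refine cost_sum_le l 7 _ _ v ?_ ?_
  · simp only [Prog.eval, h5, hj, le_refl]
  · simp [Prog.cost]

/-- `P_r`, where `r` is the value of `R`. -/
def probProg (R : Prog) : Prog :=
  mul (div (lit 1) (power (var 1) (sub (var 0) (lit 1))))
    (sum 5 (sub (var 0) (sub (var 2) R)) (sum 6 (add (sub (var 2) R) (lit 1))
      (mul (mul (mul (mul (mul (power (lit (-1)) (var 6))
        (binom (sub (var 0) (lit 1)) (add (sub (var 2) R) (var 5))))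
        (binom (sub (var 2) R) (var 6)))
        (power (sub (sub (var 2) R) (var 6)) (add (sub (var 2) R) (var 5))))
        (power (var 2) (add (sub (var 2) R) (var 5))))
        (power (sub (var 1) (mul (var 2) (var 2)))
          (sub (sub (var 0) (lit 1)) (add (sub (var 2) R) (var 5)))))))

/-- A negative loop bound counts as 0, in agreement with truncated subtraction; so the loop for
`P_r` is empty when its range of `n` is. -/
lemma floor_sub_natCast (a b : ℕ) : ⌊(a : ℚ) - b⌋₊ = a - b := by
  rw [Nat.floor_sub_natCast, Nat.floor_natCast]

/-- `R` may depend on variable 4 only, because the loops overwrite 5, 6 and 7. Variable 5 holds `n -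
(w - r)`. -/
lemma eval_probProg {l : ℕ → ℕ} {R : Prog} {v : ℕ → ℚ} {N L w r : ℕ} (h0 : v 0 = N) (h1 : v 1 = L)
    (h2 : v 2 = w) (hR : ∀ u : ℕ → ℚ, u 4 = v 4 → R.eval l u = r) (hN : 1 ≤ N) (hr : r ≤ w) :
    (probProg R).eval l v = probP N L w r := by
  have hNc : (N : ℚ) - 1 = (N - 1 : ℕ) := by rw [Nat.cast_sub hN, Nat.cast_one]
  have hrc : (w : ℚ) - r = (w - r : ℕ) := by rw [Nat.cast_sub hr]
  have e1 : (power (var 1) (sub (var 0) (lit 1))).eval l v = (L : ℚ) ^ (N - 1) :=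
    eval_power (by simp [Prog.eval, h0, hNc]) (by simp [Prog.eval, h1])
  have hk1 : ⌊((w - r : ℕ) : ℚ) + (1 : ℤ)⌋₊ = w - r + 1 := by
    exact_mod_cast Nat.floor_natCast (w - r + 1)
  have e0 : Finset.Icc (w - r) (N - 1) = Finset.Ico (w - r) N := by
    ext x; simp only [Finset.mem_Icc, Finset.mem_Ico]; omega
  rw [probProg, Prog.eval, Prog.eval, e1, probP, e0, Finset.sum_Ico_eq_sum_range]
  simp only [Prog.eval, h0, h2, hR v rfl, hrc, floor_sub_natCast]
  simp only [Int.cast_one]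
  refine congrArg _ (Finset.sum_congr rfl fun n hn => ?_)
  rw [Finset.mem_range] at hn
  have hR' := hR (Function.update v 5 n) (by simp)
  have hn2 : Function.update v 5 (n : ℚ) 2 = w := by simp [h2]
  rw [hR', hn2, hrc, ← Int.cast_one, hk1]
  refine Finset.sum_congr rfl fun m hm => ?_
  rw [Finset.mem_range] at hm
  have hsub : ((N - 1 : ℕ) : ℚ) - ((w - r : ℕ) + n) = (N - 1 - (w - r + n) : ℕ) := by
    rw [Nat.cast_sub (show w - r + n ≤ N - 1 by omega), Nat.cast_add]
  have hR2 := hR (Function.update (Function.update v 5 n) 6 m) (by simp)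
  have hR3 : ∀ t : ℚ, R.eval l (Function.update (Function.update (Function.update v 5 n) 6 m) 7 t)
    = r := fun t => hR _ (by simp)
  rw [eval_power (n := m) (x := -1), eval_binom (n := N - 1) (k := w - r + n),
    eval_binom (n := w - r) (k := m), eval_power (n := w - r + n) (x := (w : ℚ) - r - m),
    eval_power (n := w - r + n) (x := (w : ℚ)),
    eval_power (n := N - 1 - (w - r + n)) (x := (L : ℚ) - (w : ℚ) ^ 2)]
  all_goals simp [Prog.eval, h0, h1, h2, hR2, hR3, hrc, hNc, hsub, pow_two]

/-- Two nested loops of at most `w` rounds, around powers and binomials costing `O(w)` each. -/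
lemma cost_probProg {l : ℕ → ℕ} {R : Prog} {v : ℕ → ℚ} {N w r : ℕ} (h0 : v 0 = N)
    (h2 : v 2 = w) (hR : ∀ u : ℕ → ℚ, u 4 = v 4 → R.eval l u = r)
    (hRc : ∀ u : ℕ → ℚ, R.cost l u ≤ 3) (hN : 1 ≤ N) (hNw : N ≤ w) (hr : r ≤ w) :
    (probProg R).cost l v ≤ 400 * w ^ 3 := by
  have hw : 1 ≤ w := hN.trans hNw
  have hNc : (N : ℚ) - 1 = (N - 1 : ℕ) := by rw [Nat.cast_sub hN, Nat.cast_one]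
  have hrc : (w : ℚ) - r = (w - r : ℕ) := by rw [Nat.cast_sub hr]
  have hk1 : ⌊((w - r : ℕ) : ℚ) + (1 : ℤ)⌋₊ = w - r + 1 := by
    exact_mod_cast Nat.floor_natCast (w - r + 1)
  have c1 : (power (var 1) (sub (var 0) (lit 1))).cost l v ≤ 3 + 1 + (N - 1) * 2 :=
    cost_power_le (n := N - 1) (B := 1) (by simp [Prog.eval, h0, hNc]) (by simp [Prog.cost])
  have hw2 : w ≤ w ^ 2 := Nat.le_self_pow (by norm_num) w
  have hw3 : w ≤ w ^ 3 := Nat.le_self_pow (by norm_num) w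
  have c2 : (sum 5 (sub (var 0) (sub (var 2) R)) (sum 6 (add (sub (var 2) R) (lit 1))
      (mul (mul (mul (mul (mul (power (lit (-1)) (var 6))
        (binom (sub (var 0) (lit 1)) (add (sub (var 2) R) (var 5))))
        (binom (sub (var 2) R) (var 6)))
        (power (sub (sub (var 2) R) (var 6)) (add (sub (var 2) R) (var 5))))
        (power (var 2) (add (sub (var 2) R) (var 5))))
        (power (sub (var 1) (mul (var 2) (var 2)))
          (sub (sub (var 0) (lit 1)) (add (sub (var 2) R) (var 5))))))).cost l v
      ≤ (sub (var 0) (sub (var 2) R)).cost l v + 1 + w * (300 * w ^ 2 + 1) := by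
    refine cost_sum_le l 5 _ _ v ?_ fun n hn => ?_
    · simp only [Prog.eval, h0, h2, hR v rfl, hrc, floor_sub_natCast]; omega
    simp only [Prog.eval, h0, h2, hR v rfl, hrc, floor_sub_natCast] at hn
    have hR' := hR (Function.update v 5 n) (by simp)
    refine (cost_sum_le (K := w) (B := 250 * w) l 6 _ _ _ ?_ fun m hm => ?_).trans ?_
    · simp only [Prog.eval, hR']
      rw [Function.update_of_ne (by norm_num), h2, hrc, hk1]
      -- For `r = 0` the outer loop is empty as `N ≤ w`, so `r ≥ 1` here and `w - r + 1 ≤ w`.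
      omega
    · have hn2 : Function.update v 5 (n : ℚ) 2 = w := by simp [h2]
      simp only [Prog.eval, hR', hn2, hrc, hk1] at hm
      have hsub : ((N - 1 : ℕ) : ℚ) - ((w - r : ℕ) + n) = (N - 1 - (w - r + n) : ℕ) := by
        rw [Nat.cast_sub (show w - r + n ≤ N - 1 by omega), Nat.cast_add]
      have hR2 := hR (Function.update (Function.update v 5 n) 6 m) (by simp)
      have hRc2 := hRc (Function.update (Function.update v 5 n) 6 m)
      have hRc3 := fun t : ℚ =>
        hRc (Function.update (Function.update (Function.update v 5 n) 6 m) 7 t)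
      generalize hu : Function.update (Function.update v 5 (n : ℚ)) 6 (m : ℚ) = u at *
      have u0 : u 0 = N := by simp [← hu, h0]
      have u2 : u 2 = w := by simp [← hu, h2]
      have u5 : u 5 = n := by simp [← hu]
      have u6 : u 6 = m := by simp [← hu]
      have d1 := cost_power_le (l := l) (v := u) (b := lit (-1)) (e := var 6) (n := m) (B := 1)
        (by simp [Prog.eval, u6]) (by simp [Prog.cost])
      have d2 := cost_binom_le (l := l) (v := u) (a := sub (var 0) (lit 1))
        (b := add (sub (var 2) R) (var 5)) (k := w - r + n) (B := 3)
        (by simp [Prog.eval, u2, u5, hR2, hrc]) (by simp [Prog.cost])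
      have d3 := cost_binom_le (l := l) (v := u) (a := sub (var 2) R)
        (b := var 6) (k := m) (B := 5)
        (by simp [Prog.eval, u6]) (fun t => by have := hRc3 t; simp only [Prog.cost]; omega)
      have d4 := cost_power_le (l := l) (v := u) (b := sub (sub (var 2) R) (var 6))
        (e := add (sub (var 2) R) (var 5)) (n := w - r + n) (B := 7)
        (by simp [Prog.eval, u2, u5, hR2, hrc])
        (fun t => by have := hRc3 t; simp only [Prog.cost]; omega)
      have d5 := cost_power_le (l := l) (v := u) (b := var 2)
        (e := add (sub (var 2) R) (var 5)) (n := w - r + n) (B := 1)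
        (by simp [Prog.eval, u2, u5, hR2, hrc]) (fun t => by simp [Prog.cost])
      have d6 := cost_power_le (l := l) (v := u) (b := sub (var 1) (mul (var 2) (var 2)))
        (e := sub (sub (var 0) (lit 1)) (add (sub (var 2) R) (var 5))) (n := N - 1 - (w - r + n))
        (B := 5)
        (by simp [Prog.eval, u0, u2, u5, hR2, hrc, hNc, hsub]) (fun t => by simp [Prog.cost])
      simp only [Prog.cost] at d1 d2 d3 d4 d5 d6 ⊢
      omega
    · have := hRc (Function.update v 5 n)
      rw [show w * (250 * w + 1) = 250 * w ^ 2 + w by ring]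
      simp only [Prog.cost]
      omega
  have := hRc v
  rw [show w * (300 * w ^ 2 + 1) = 300 * w ^ 3 + w by ring] at c2
  rw [probProg, Prog.cost, Prog.cost]
  simp only [Prog.cost] at c1 c2 ⊢
  omega

/-- The closed form. -/
def closedProg : Prog :=
  add (mul (mul (probProg (lit 1)) (var 2)) (F1Prog (var 1)))
    (sum 4 (sub (var 2) (lit 1)) (mul (probProg (add (var 4) (lit 2)))
      (sum 5 (sub (sub (var 2) (var 4)) (lit 1))
        (div (mul (fact (sub (sub (var 2) (var 5)) (lit 2))) (sum 6 (var 2) (F1Prog zetaProg)))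
          (mul (fact (var 4)) (fact (sub (sub (sub (var 2) (var 5)) (var 4)) (lit 2))))))))

/-- Loops start at 0, so variable 4 holds `r - 2` and variable 5 holds `j - 1`. -/
lemma eval_closedProg (l : ℕ → ℕ) {N L w T : ℕ} (hN : 1 ≤ N) (hNw : N ≤ w) :
    closedProg.eval l (inputs N L w T) = closedForm N L w T l := by
  have hw : 1 ≤ w := hN.trans hNw
  have i0 : inputs N L w T 0 = N := rfl
  have i1 : inputs N L w T 1 = L := rfl
  have i2 : inputs N L w T 2 = w := rfl
  have i3 : inputs N L w T 3 = T := rfl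
  have hw1 : (w : ℚ) - (1 : ℤ) = (w - 1 : ℕ) := by rw [Nat.cast_sub hw]; simp
  have hI : Finset.Icc 2 w = Finset.Ico 2 (w + 1) := by
    ext x; simp only [Finset.mem_Icc, Finset.mem_Ico]; omega
  rw [closedProg, closedForm, hI, Finset.sum_Ico_eq_sum_range]
  simp only [Prog.eval, i2]
  rw [eval_probProg (R := lit 1) (r := 1) i0 i1 i2 (by simp [Prog.eval]) hN hw,
    eval_F1Prog (n := L) i1 i3 (by simp [Prog.eval, i1]), hw1, Nat.floor_natCast,
    show w + 1 - 2 = w - 1 by omega]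
  congr 1
  refine Finset.sum_congr rfl fun t ht => ?_
  rw [Finset.mem_range] at ht
  rw [eval_probProg (r := 2 + t) (N := N) (L := L) (w := w) (by simp [i0]) (by simp [i1])
    (by simp [i2]) (fun u hu => by simp [Prog.eval, hu, add_comm]) hN (by omega)]
  congr 1
  have hI : Finset.Icc 1 (w + 1 - (2 + t)) = Finset.Ico 1 (w + 1 - (2 + t) + 1) := by
    ext x; simp only [Finset.mem_Icc, Finset.mem_Ico]; omega
  rw [hI, Finset.sum_Ico_eq_sum_range]
  have hf : (Function.update (inputs N L w T) 4 (t : ℚ) 2 -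
      Function.update (inputs N L w T) 4 (t : ℚ) 4 - (1 : ℤ)) = (w + 1 - (2 + t) : ℕ) := by
    rw [Nat.cast_sub (by omega)]
    simp [i2]; ring
  rw [hf, Nat.floor_natCast, Nat.add_sub_cancel]
  refine Finset.sum_congr rfl fun j hj => ?_
  rw [Finset.mem_range] at hj
  generalize hu : Function.update (Function.update (inputs N L w T) 4 (t : ℚ)) 5 (j : ℚ) = u
  have u1 : u 1 = L := by simp [← hu, i1]
  have u2 : u 2 = w := by simp [← hu, i2]
  have u3 : u 3 = T := by simp [← hu, i3]
  have u4 : u 4 = t := by simp [← hu]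
  have u5 : u 5 = j := by simp [← hu]
  rw [eval_fact (n := w - (1 + j) - 1), eval_fact (n := 2 + t - 2),
    eval_fact (n := w - (1 + j) - (2 + t - 1)), u2, Nat.floor_natCast]
  · congr 2
    refine Finset.sum_congr rfl fun k _ => ?_
    rw [add_comm 1 j]
    refine eval_F1Prog (by simp [u1]) (by simp [u3]) (eval_zetaProg (w := w) ?_ ?_ ?_) <;>
      simp [u2, u5]
  · rw [Nat.cast_sub (by omega), Nat.cast_sub (by omega)]
    simp [Prog.eval, u2, u4, u5]
    ring
  · simp [Prog.eval, u4]
  · rw [Nat.cast_sub (by omega), Nat.cast_sub (by omega)]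
    simp [Prog.eval, u2, u5]; ring

/-- Each of at most `w` values of `r` costs `O(w ^ 3)` for `P_r` and `O(w ^ 3)` for the pairs `(j,
k)`, each with a sum `ζ` of `O(w)` terms. -/
lemma cost_closedProg (l : ℕ → ℕ) {N L w T : ℕ} (hN : 1 ≤ N) (hNw : N ≤ w) :
    closedProg.cost l (inputs N L w T) ≤ 10000 * w ^ 4 := by
  have hw : 1 ≤ w := hN.trans hNw
  have i0 : inputs N L w T 0 = N := rfl
  have i2 : inputs N L w T 2 = w := rfl
  have hw1 : (w : ℚ) - (1 : ℤ) = (w - 1 : ℕ) := by rw [Nat.cast_sub hw]; simp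
  have c1 := cost_probProg (l := l) (R := lit 1) (r := 1) i0 i2 (by simp [Prog.eval])
    (by simp [Prog.cost]) hN hNw hw
  have c2 := cost_F1Prog (l := l) (d := var 1) (v := inputs N L w T)
  have p2 : w ≤ w ^ 2 := Nat.le_self_pow (by norm_num) w
  have p3 : w ^ 2 ≤ w ^ 3 := Nat.pow_le_pow_right hw (by norm_num)
  have p4 : w ^ 3 ≤ w ^ 4 := Nat.pow_le_pow_right hw (by norm_num)
  have c3 : (sum 4 (sub (var 2) (lit 1)) (mul (probProg (add (var 4) (lit 2)))
      (sum 5 (sub (sub (var 2) (var 4)) (lit 1))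
        (div (mul (fact (sub (sub (var 2) (var 5)) (lit 2))) (sum 6 (var 2) (F1Prog zetaProg)))
          (mul (fact (var 4)) (fact (sub (sub (sub (var 2) (var 5)) (var 4)) (lit 2)))))))).cost
      l (inputs N L w T) ≤ 3 + 1 + w * (8000 * w ^ 3 + 1) := by
    refine cost_sum_le l 4 _ _ _ ?_ fun t ht => ?_
    · simp only [Prog.eval, i2, hw1, Nat.floor_natCast]; omega
    simp only [Prog.eval, i2, hw1, Nat.floor_natCast] at ht
    have d1 := cost_probProg (l := l) (R := add (var 4) (lit 2)) (r := 2 + t) (N := N) (w := w)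
      (v := Function.update (inputs N L w T) 4 t) (by simp [i0])
      (by simp [i2]) (fun u hu => by simp [Prog.eval, hu, add_comm]) (by simp [Prog.cost])
      hN hNw (by omega)
    have hf : (Function.update (inputs N L w T) 4 (t : ℚ) 2 -
        Function.update (inputs N L w T) 4 (t : ℚ) 4 - (1 : ℤ)) = (w + 1 - (2 + t) : ℕ) := by
      rw [Nat.cast_sub (by omega)]
      simp [i2]; ring
    have d2 : (sum 5 (sub (sub (var 2) (var 4)) (lit 1))
        (div (mul (fact (sub (sub (var 2) (var 5)) (lit 2))) (sum 6 (var 2) (F1Prog zetaProg)))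
          (mul (fact (var 4)) (fact (sub (sub (sub (var 2) (var 5)) (var 4)) (lit 2)))))).cost
      l (Function.update (inputs N L w T) 4 t) ≤ 5 + 1 + w * (6000 * w ^ 2 + 1) := by
      refine cost_sum_le l 5 _ _ _ ?_ fun j hj => ?_
      · simp only [Prog.eval, hf, Nat.floor_natCast]; omega
      simp only [Prog.eval, hf, Nat.floor_natCast] at hj
      generalize hu : Function.update (Function.update (inputs N L w T) 4 (t : ℚ)) 5 (j : ℚ) = u
      have u2 : u 2 = w := by simp [← hu, i2]
      have u4 : u 4 = t := by simp [← hu]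
      have u5 : u 5 = j := by simp [← hu]
      have f1 := cost_fact_le (l := l) (v := u) (e := sub (sub (var 2) (var 5)) (lit 2))
        (n := w - j - 2) (by
          rw [Nat.cast_sub (by omega), Nat.cast_sub (by omega)]; simp [Prog.eval, u2, u5])
      have f2 := cost_fact_le (l := l) (v := u) (e := var 4) (n := t) (by simp [Prog.eval, u4])
      have f3 := cost_fact_le (l := l) (v := u)
        (e := sub (sub (sub (var 2) (var 5)) (var 4)) (lit 2))
        (n := w - j - t - 2) (by
          rw [Nat.cast_sub (by omega), Nat.cast_sub (by omega), Nat.cast_sub (by omega)]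
          simp [Prog.eval, u2, u4, u5])
      have f4 : (sum 6 (var 2) (F1Prog zetaProg)).cost l u ≤ 1 + 1 + w * (4000 * w + 1) := by
        refine cost_sum_le l 6 _ _ _ (by simp [Prog.eval, u2]) fun k _ => ?_
        have g1 := cost_F1Prog (l := l) (d := zetaProg) (v := Function.update u 6 k)
        have g2 := cost_zetaProg (l := l) (v := Function.update u 6 k) (j := j) (by simp [u5])
        omega
      rw [show w * (4000 * w + 1) = 4000 * w ^ 2 + w by ring] at f4
      simp only [Prog.cost] at f1 f2 f3 f4 ⊢
      omega
    rw [show w * (6000 * w ^ 2 + 1) = 6000 * w ^ 3 + w by ring] at d2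
    simp only [Prog.cost] at d2 ⊢
    omega
  rw [show w * (8000 * w ^ 3 + 1) = 8000 * w ^ 4 + w by ring] at c3
  rw [closedProg]
  simp only [Prog.cost] at c2 c3 ⊢
  omega

end Prog

lemma exists_closedForm_program : ∃ (e : Prog) (C : ℕ),
      (∀ (N L w T : ℕ) (l : ℕ → ℕ), 1 ≤ N → N ≤ w →
        e.eval l (inputs N L w T) = closedForm N L w T l ∧
        e.cost l (inputs N L w T) ≤ C * w ^ 4) ∧
      (∀ (N p L T : ℕ) (l : ℕ → ℕ), 1 ≤ N → IsLeastPrimeGE N p →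
        e.cost l (inputs N L p T) ≤ C * N ^ 4) := by
  refine ⟨Prog.closedProg, 160000, fun N L w T l hN hNw => ⟨Prog.eval_closedProg l hN hNw, ?_⟩,
    fun N p L T l hN hp => ?_⟩
  · exact (Prog.cost_closedProg l hN hNw).trans (Nat.mul_le_mul_right _ (by norm_num))
  -- Bertrand's postulate bounds the least prime `p ≥ N` by `2 N`, whence `160000 = 10000 * 2 ^ 4`.
  · obtain ⟨b, hb, hNb, hb2⟩ := Nat.exists_prime_lt_and_le_two_mul N (by omega)
    have hpN : p ≤ 2 * N := (hp.2 ⟨hb, hNb.le⟩).trans hb2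
    calc _ ≤ 10000 * p ^ 4 := Prog.cost_closedProg l hN hp.1.2
      _ ≤ 10000 * (2 * N) ^ 4 := by gcongr
      _ = 160000 * N ^ 4 := by ring

/-! ### The long-run average of the age of information -/

lemma bounded_of_eventually_periodic {S : ℕ → ℝ} {P t₀ : ℕ} (hP : 0 < P)
    (h : ∀ n ≥ t₀, S (n + P) = S n) : ∃ M, ∀ n, |S n| ≤ M := by
  refine ⟨∑ m ∈ Finset.range (t₀ + P), |S m|, fun n => ?_⟩
  induction n using Nat.strong_induction_on with
  | _ n ih =>
    rcases lt_or_ge n (t₀ + P) with hn | hn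
    · exact Finset.single_le_sum (f := fun m => |S m|) (fun _ _ => abs_nonneg _)
        (Finset.mem_range.2 hn)
    · have h1 := h (n - P) (by omega)
      rw [Nat.sub_add_cancel (by omega)] at h1
      rw [h1]
      exact ih _ (by omega)

/-- After subtraction of the mean over one period the partial sums are themselves eventually
periodic, hence bounded. -/
lemma tendsto_average_of_eventually_periodic {f : ℕ → ℝ} {P t₀ : ℕ} (hP : 0 < P)
    (h : ∀ t ≥ t₀, f (t + P) = f t) :
    Tendsto (fun n : ℕ => (1 / (n : ℝ)) * ∑ t ∈ Finset.range (n + 1), f t) atTop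
      (𝓝 ((∑ t ∈ Finset.range P, f (t₀ + t)) / P)) := by
  set a := (∑ t ∈ Finset.range P, f (t₀ + t)) / P with ha
  have hP' : (P : ℝ) ≠ 0 := by positivity
  set S : ℕ → ℝ := fun n => ∑ t ∈ Finset.range n, (f t - a) with hS
  have hper : ∀ n ≥ t₀, S (n + P) = S n := by
    intro n hn
    induction n, hn using Nat.le_induction with
    | base =>
      simp only [hS, Finset.sum_range_add, Finset.sum_sub_distrib, Finset.sum_const,
        Finset.card_range, nsmul_eq_mul, ha]
      field_simp
      push_cast
      ring
    | succ n hn ih =>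
      have h1 : S (n + 1 + P) = S (n + P) + (f (n + P) - a) := by
        rw [show n + 1 + P = n + P + 1 by ring]; exact Finset.sum_range_succ _ _
      have h2 : S (n + 1) = S n + (f n - a) := Finset.sum_range_succ _ _
      rw [h1, h2, ih, h n hn]
  obtain ⟨M, hM⟩ := bounded_of_eventually_periodic hP hper
  -- The extra `a` arises because `n + 1` terms are divided by `n`.
  have h0 : Tendsto (fun n : ℕ => (1 / (n : ℝ)) * (S (n + 1) + a)) atTop (𝓝 0) := by
    refine squeeze_zero_norm (a := fun n : ℕ => (M + |a|) * (1 / (n : ℝ))) (fun n => ?_) ?_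
    · rw [norm_mul, mul_comm, Real.norm_eq_abs, Real.norm_eq_abs, abs_of_nonneg (a := 1 / (n : ℝ)) (by positivity)]
      refine mul_le_mul_of_nonneg_right ?_ (one_div_nonneg.2 n.cast_nonneg)
      exact (abs_add_le _ _).trans (by gcongr; exact hM _)
    · simpa using tendsto_one_div_atTop_nhds_zero_nat.const_mul (M + |a|)
  have h1 := h0.add_const a
  rw [zero_add] at h1
  refine h1.congr' ?_
  filter_upwards [eventually_ge_atTop 1] with n hn
  have hn' : (n : ℝ) ≠ 0 := by positivity
  simp only [hS, Finset.sum_sub_distrib, Finset.sum_const, Finset.card_range, nsmul_eq_mul]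
  push_cast
  field_simp
  ring

lemma sum_range_mul_zmod {L T : ℕ} [NeZero L] [NeZero T] (h : Nat.Coprime L T)
    (F : ZMod L → ZMod T → ℝ) :
    ∑ t ∈ Finset.range (L * T), F t t = ∑ a : ZMod L, ∑ b : ZMod T, F a b := by
  rw [← Fintype.sum_prod_type' F]
  refine Finset.sum_bij (fun t _ => ((t : ZMod L), (t : ZMod T))) (fun _ _ => Finset.mem_univ _)
    ?_ ?_ fun _ _ => rfl
  · intro t ht t' ht' he
    rw [Prod.mk.injEq, ZMod.natCast_eq_natCast_iff, ZMod.natCast_eq_natCast_iff] at he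
    exact Nat.ModEq.eq_of_lt_of_lt ((Nat.modEq_and_modEq_iff_modEq_mul h).1 he)
      (Finset.mem_range.1 ht) (Finset.mem_range.1 ht')
  · rintro ⟨a, b⟩ _
    have h1 := (Nat.chineseRemainder h a.val b.val).2
    refine ⟨Nat.chineseRemainder h a.val b.val, Finset.mem_range.2
      (Nat.chineseRemainder_lt_mul h _ _ (NeZero.ne L) (NeZero.ne T)), ?_⟩
    exact Prod.ext
      (((ZMod.natCast_eq_natCast_iff _ _ _).2 h1.1).trans (ZMod.natCast_zmod_val a))
      (((ZMod.natCast_eq_natCast_iff _ _ _).2 h1.2).trans (ZMod.natCast_zmod_val b))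

lemma sum_sum_add_right {L T : ℕ} [NeZero L] [NeZero T] (F : ZMod L → ZMod T → ℝ) (c : ZMod L)
    (c' : ZMod T) :
    ∑ a : ZMod L, ∑ b : ZMod T, F (a + c) (b + c') = ∑ a : ZMod L, ∑ b : ZMod T, F a b :=
  (Equiv.sum_comp (Equiv.addRight c) fun a => ∑ b : ZMod T, F a (b + c')).trans
    (Finset.sum_congr rfl fun a _ => Equiv.sum_comp (Equiv.addRight c') fun b => F a b)

lemma sum_zmod_val (T : ℕ) [NeZero T] :
    ∑ b : ZMod T, (b.val : ℝ) = T * ((T : ℝ) - 1) / 2 := by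
  have h1 : ∑ b : ZMod T, (b.val : ℝ) = ∑ b ∈ Finset.range T, (b : ℝ) := by
    refine Finset.sum_bij (fun b _ => b.val) (fun b _ => Finset.mem_range.2 (ZMod.val_lt b))
      (fun _ _ _ _ h => ZMod.val_injective T h) (fun b hb => ⟨b, Finset.mem_univ _, ?_⟩)
      fun _ _ => rfl
    exact ZMod.val_cast_of_lt (Finset.mem_range.1 hb)
  have h2 := Finset.sum_range_id_mul_two T
  have h3 : ((∑ b ∈ Finset.range T, b : ℕ) : ℝ) * 2 = T * ((T : ℝ) - 1) := by
    have hT : 1 ≤ T := NeZero.one_le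
    have := congrArg (Nat.cast : ℕ → ℝ) h2
    push_cast [Nat.cast_sub hT] at this ⊢
    exact this
  rw [h1]
  push_cast at h3
  linarith

/-- The most recent success at or before the local time `a` (modulo `L`) lies `u` slots back. -/
def LastSuccess {L : ℕ} (e : ZMod L → Prop) (a : ZMod L) (u : ℕ) : Prop :=
  e (a - u) ∧ ∀ v < u, ¬ e (a - v)

lemma LastSuccess.unique {L : ℕ} {e : ZMod L → Prop} {a : ZMod L} {u u' : ℕ}
    (h : LastSuccess e a u) (h' : LastSuccess e a u') : u = u' := by
  rcases lt_trichotomy u u' with hlt | heq | hlt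
  · exact absurd h.1 (h'.2 u hlt)
  · exact heq
  · exact absurd h'.1 (h.2 u' hlt)

lemma exists_lastSuccess {L : ℕ} [NeZero L] {e : ZMod L → Prop} (he : ∃ y, e y) (a : ZMod L) :
    ∃ u < L, LastSuccess e a u := by
  classical
  obtain ⟨y, hy⟩ := he
  have h1 : ∃ u : ℕ, e (a - u) := ⟨(a - y).val, by simpa using hy⟩
  refine ⟨Nat.find h1, ?_, Nat.find_spec h1, fun v hv => Nat.find_min h1 hv⟩
  refine lt_of_le_of_lt (Nat.find_min' h1 (m := (a - y).val) (by simpa using hy)) (ZMod.val_lt _)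

open Classical in
/-- The age at local time `(a, b)` modulo `(L, T)`, as a sum over the candidate delays. -/
noncomputable def stationaryAge {L T : ℕ} (e : ZMod L → Prop) (a : ZMod L) (b : ZMod T) : ℝ :=
  ∑ u ∈ Finset.range L, if LastSuccess e a u then ((u : ℝ) + (b - u).val) else 0

lemma stationaryAge_eq {L T : ℕ} {e : ZMod L → Prop} {a : ZMod L} (b : ZMod T) {u : ℕ}
    (hu : u < L) (h : LastSuccess e a u) : stationaryAge e a b = (u : ℝ) + (b - u).val := by
  rw [stationaryAge, Finset.sum_eq_single u]
  · rw [if_pos h]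
  · intro u' _ hne
    rw [if_neg fun h' => hne (h'.unique h)]
  · intro hn; exact absurd (Finset.mem_range.2 hu) hn

open Classical in
-- Summing over `b` replaces the frame phase by its mean `(T - 1) / 2`; the substitution `y = a - u`
-- then indexes by the last success instead of the present slot.
lemma sum_stationaryAge {L T : ℕ} [NeZero L] [NeZero T] (e : ZMod L → Prop) :
    ∑ a : ZMod L, ∑ b : ZMod T, stationaryAge e a b =
      ∑ y : ZMod L, ∑ u ∈ Finset.range L, if e y ∧ ∀ v, 1 ≤ v → v ≤ u → ¬ e (y + v)
        then T * ((u : ℝ) + ((T : ℝ) - 1) / 2) else 0 := by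
  have h1 : ∀ a : ZMod L, ∑ b : ZMod T, stationaryAge e a b =
      ∑ u ∈ Finset.range L, if LastSuccess e a u then T * ((u : ℝ) + ((T : ℝ) - 1) / 2) else 0 := by
    intro a
    simp only [stationaryAge]
    rw [Finset.sum_comm]
    refine Finset.sum_congr rfl fun u _ => ?_
    split_ifs
    · have h2 : ∑ b : ZMod T, ((b - (u : ZMod T)).val : ℝ) = ∑ b : ZMod T, (b.val : ℝ) :=
        Equiv.sum_comp (Equiv.subRight (u : ZMod T)) fun b => (b.val : ℝ)
      rw [Finset.sum_add_distrib, h2, sum_zmod_val]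
      simp [ZMod.card]
      ring
    · simp
  rw [Finset.sum_congr rfl fun a _ => h1 a, Finset.sum_comm]
  symm
  rw [Finset.sum_comm]
  refine Finset.sum_congr rfl fun u _ => ?_
  rw [← Equiv.sum_comp (Equiv.subRight (u : ZMod L))]
  refine Finset.sum_congr rfl fun a _ => if_congr ?_ rfl rfl
  rw [LastSuccess, Equiv.subRight_apply]
  refine and_congr_right fun _ => ⟨fun h v hv => ?_, fun h v hv hvu => ?_⟩
  · have := h (u - v) (by omega) (by omega)
    rw [Nat.cast_sub hv.le] at this
    simpa using this
  · have := h (u - v) (by omega)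
    rw [Nat.cast_sub hvu] at this
    rwa [show a - u + v = a - (u - v) by ring]

/-- From slot `L` on every user has started, so only local clocks modulo `L` matter. -/
lemma delivers_iff {N L : ℕ} {s : Fin N → ℕ → Bool} (hs : ∀ j, Function.Periodic (s j) L)
    (hL : 0 < L) (τ : Fin N → Fin L) (i : Fin N) {t : ℕ} (ht : L ≤ t) :
    delivers s τ i t = true ↔ (t - τ i) % L ∈ successfulOnes s τ i := by
  have hle : ∀ j, (τ j : ℕ) ≤ t := fun j => (τ j).2.le.trans ht
  have htr : ∀ j, transmits s τ j t = s j (t - τ j) := fun j => by simp [transmits, hle j]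
  simp only [delivers, decide_eq_true_eq, htr, successfulOnes, Finset.mem_filter, mem_ones,
    (hs i).map_mod_nat, Nat.mod_lt _ hL, true_and]
  refine and_congr_right fun _ => forall_congr' fun j => forall_congr' fun _ => ?_
  rw [← (hs j).map_mod_nat (t - τ j), ← (hs j).map_mod_nat ((t - τ i) % L + τ i + (L - τ j))]
  have : (t - τ j) % L = ((t - τ i) % L + τ i + (L - τ j)) % L := by
    rw [add_assoc, Nat.mod_add_mod]
    have h1 := hle i
    have h2 := hle j
    have h3 := (τ j).2
    rw [show t - τ i + (τ i + (L - τ j)) = t - τ j + L by omega, Nat.add_mod_right]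
  rw [this]

lemma aoi_add {N L T : ℕ} {s : Fin N → ℕ → Bool} {τ : Fin N → Fin L} {i : Fin N} {a₀ t u : ℕ}
    (ht : τ i ≤ t) (h : delivers s τ i t = true)
    (h' : ∀ v, 1 ≤ v → v ≤ u → delivers s τ i (t + v) = false) :
    aoi T s τ i a₀ (t + u) = (t - τ i) % T + u := by
  induction u with
  | zero =>
    have hg : t - genTime T τ i t = (t - τ i) % T := by
      have := Nat.div_add_mod (t - τ i) T
      rw [genTime]; omega
    cases t with
    | zero => simp [aoi, h]
    | succ t => simp [aoi, h, hg]
  | succ u ih =>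
    have h1 := h' (u + 1) (by omega) le_rfl
    rw [← add_assoc] at h1 ⊢
    rw [aoi, h1, ih fun v hv hvu => h' v hv (by omega)]
    simp [add_assoc]

/-- The last success lies fewer than `L` slots back, hence after slot `L` if `t ≥ 2 L`; the value
`a₀` has been forgotten by then. -/
lemma aoi_eq_stationaryAge {N L T : ℕ} [NeZero L] [NeZero T] {s : Fin N → ℕ → Bool}
    (hs : IsMHUI N L s) (τ : Fin N → Fin L) (i : Fin N) (a₀ : ℕ) {t : ℕ}
    (ht : 2 * L ≤ t) :
    (aoi T s τ i a₀ t : ℝ) = stationaryAge (fun z : ZMod L => z.val ∈ successfulOnes s τ i)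
      ((t : ZMod L) - ((τ i : ℕ) : ZMod L)) ((t : ZMod T) - ((τ i : ℕ) : ZMod T)) := by
  have hL : 0 < L := NeZero.pos L
  have hne : ∃ z : ZMod L, z.val ∈ successfulOnes s τ i := by
    obtain ⟨x, hx⟩ := successfulOnes_nonempty hs hL τ i
    refine ⟨(x : ZMod L), ?_⟩
    rwa [ZMod.val_cast_of_lt (mem_ones.1 (successfulOnes_subset s τ i hx)).1]
  have key : ∀ v ≤ L, (((t : ZMod L) - ((τ i : ℕ) : ZMod L)) - v).val ∈ successfulOnes s τ i ↔
      delivers s τ i (t - v) = true := by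
    intro v hv
    have hτ := (τ i).2
    rw [delivers_iff hs.periodic hL τ i (by omega), ← ZMod.val_natCast,
      Nat.cast_sub (by omega), Nat.cast_sub (by omega), sub_right_comm]
  obtain ⟨u, hu, hlast⟩ := exists_lastSuccess hne ((t : ZMod L) - ((τ i : ℕ) : ZMod L))
  rw [stationaryAge_eq _ hu hlast]
  have hτ := (τ i).2
  have h1 := aoi_add (T := T) (s := s) (τ := τ) (i := i) (a₀ := a₀) (t := t - u) (u := u)
    (by omega) ((key u hu.le).1 hlast.1) (by
      intro v hv hvu
      have h2 : ¬ _ ∈ _ := hlast.2 (u - v) (by omega)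
      rw [key _ (by omega), show t - (u - v) = t - u + v by omega] at h2
      simpa using h2)
  rw [Nat.sub_add_cancel (by omega)] at h1
  rw [h1, sub_right_comm, ← Nat.cast_sub (by omega), ← Nat.cast_sub (by omega), ZMod.val_natCast]
  push_cast
  ring

/-- The mean waiting age `(u + (T - 1) / 2) / L` contributed by a slot `u` slots after the last
success. -/
def slotAge (L T u : ℕ) : ℚ := ((u : ℚ) + ((T : ℚ) - 1) / 2) / L

/-- The average age of information if the set of successful ones is `E`. -/
def averageAge (L T : ℕ) (E : Finset ℕ) : ℚ :=
  ∑ y ∈ E, ∑ u ∈ Finset.range L,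
    if ∀ v ∈ Finset.Icc 1 u, (y + v) % L ∉ E then slotAge L T u else 0

/-- From slot `2 L` on the age has period `L * T`. By coprimality one period is a sum over all pairs
of residues, which absorbs the shifts by `2 L` and `τ i`. -/
lemma isAverageAoI_averageAge {N L T : ℕ} {s : Fin N → ℕ → Bool} (hs : IsMHUI N L s)
    (hL : 0 < L) (hT : 0 < T) (hTL : Nat.gcd T L = 1) (τ : Fin N → Fin L) (i : Fin N) (a₀ : ℕ) :
    IsAverageAoI T s τ i a₀ (averageAge L T (successfulOnes s τ i) : ℚ) := by
  classical
  have : NeZero L := ⟨hL.ne'⟩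
  have : NeZero T := ⟨hT.ne'⟩
  set e : ZMod L → Prop := fun z => z.val ∈ successfulOnes s τ i with he
  have hage : ∀ t ≥ 2 * L, (aoi T s τ i a₀ t : ℝ) = stationaryAge e
      ((t : ZMod L) - ((τ i : ℕ) : ZMod L)) ((t : ZMod T) - ((τ i : ℕ) : ZMod T)) :=
    fun t ht => aoi_eq_stationaryAge hs τ i a₀ ht
  have h1 := tendsto_average_of_eventually_periodic (f := fun t => (aoi T s τ i a₀ t : ℝ))
    (P := L * T) (t₀ := 2 * L) (by positivity) (by
      intro t ht
      simp only [hage t ht, hage (t + L * T) (by omega)]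
      push_cast
      simp)
  rw [IsAverageAoI]
  convert h1 using 2
  have h2 : ∀ t : ℕ, (aoi T s τ i a₀ (2 * L + t) : ℝ) = stationaryAge e
      ((t : ZMod L) + (((2 * L : ℕ) : ZMod L) - ((τ i : ℕ) : ZMod L)))
      ((t : ZMod T) + (((2 * L : ℕ) : ZMod T) - ((τ i : ℕ) : ZMod T))) := by
    intro t
    rw [hage _ (by omega)]
    push_cast
    congr 1 <;> ring
  rw [Finset.sum_congr rfl fun t _ => h2 t,
    sum_range_mul_zmod ((Nat.coprime_comm).1 hTL) fun a b => stationaryAge e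
      (a + (((2 * L : ℕ) : ZMod L) - ((τ i : ℕ) : ZMod L))) (b + (((2 * L : ℕ) : ZMod T) - ((τ i : ℕ) : ZMod T))),
    sum_sum_add_right (stationaryAge e), sum_stationaryAge]
  have hE : ∀ x ∈ successfulOnes s τ i, x < L := fun x hx =>
    (mem_ones.1 (successfulOnes_subset s τ i hx)).1
  simp only [ite_and]
  rw [Finset.sum_congr rfl (g := fun y : ZMod L => if e y then ∑ u ∈ Finset.range L,
    (if ∀ v, 1 ≤ v → v ≤ u → ¬ e (y + v) then T * ((u : ℝ) + ((T : ℝ) - 1) / 2) else 0) else 0)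
    fun y _ => by
      by_cases hy : e y
      · simp only [hy, if_true]
        congr!
      · simp only [hy, if_false, Finset.sum_const_zero], ← Finset.sum_filter, Finset.sum_div]
  rw [averageAge]
  push_cast
  refine Finset.sum_bij (fun y _ => (y : ZMod L)) ?_ ?_ ?_ ?_
  · intro y hy
    simp [he, ZMod.val_cast_of_lt (hE y hy), hy]
  · intro y hy y' hy' h
    have := congrArg ZMod.val h
    rwa [ZMod.val_cast_of_lt (hE y hy), ZMod.val_cast_of_lt (hE y' hy')] at this
  · intro z hz
    exact ⟨z.val, by simpa [he] using hz, by simp⟩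
  · intro y hy
    rw [Finset.sum_div]
    refine Finset.sum_congr rfl fun u _ => ?_
    have hiff : (∀ v ∈ Finset.Icc 1 u, (y + v) % L ∉ successfulOnes s τ i) ↔
        ∀ v, 1 ≤ v → v ≤ u → ¬ e (y + v) := by
      simp only [Finset.mem_Icc, and_imp, he, ← Nat.cast_add, ZMod.val_natCast]
    rw [if_congr hiff rfl rfl]
    have hL' : (L : ℝ) ≠ 0 := by positivity
    have hT' : (T : ℝ) ≠ 0 := by positivity
    split_ifs
    · rw [slotAge]; push_cast; field_simp
    · simp

/-! ### Positions of the ones of a periodic sequence -/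

section Positions

variable {L w : ℕ} {s : ℕ → Bool}

lemma infinite_setOf_true (hs : Function.Periodic s L) (hL : 0 < L) (hw : 0 < hammingWt L s) :
    {t | s t = true}.Infinite := by
  obtain ⟨x, hx⟩ := Finset.card_pos.1 hw
  refine Set.infinite_of_not_bddAbove fun ⟨b, hb⟩ => ?_
  have h1 : s (x + (b + 1) * L) = true := by
    exact (hs.nat_mul (b + 1) x).trans (mem_ones.1 hx).2
  have h2 : x + (b + 1) * L ≤ b := hb h1
  nlinarith

lemma count_period : Nat.count (fun t => s t = true) L = hammingWt L s := by
  rw [Nat.count_eq_card_filter_range]; rfl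

/-- `Nat.nth` enumerates the ones of all periods, so cyclic distances become differences of this
sequence; even the wrap-around gap needs no special case later. -/
lemma nth_add_hammingWt (hs : Function.Periodic s L) (hL : 0 < L) (hw : hammingWt L s = w)
    (hw0 : 0 < w) (n : ℕ) :
    Nat.nth (fun t => s t = true) (n + w) = Nat.nth (fun t => s t = true) n + L := by
  have hinf := infinite_setOf_true hs hL (hw ▸ hw0)
  have h1 : s (Nat.nth (fun t => s t = true) n + L) = true := by
    rw [hs]; exact Nat.nth_mem_of_infinite hinf n
  have h2 : Nat.count (fun t => s t = true) (Nat.nth (fun t => s t = true) n + L) = n + w := by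
    have h3 : (fun k => s (L + k) = true) = fun k => s k = true := by
      funext k; rw [add_comm, hs]
    rw [add_comm, Nat.count_add, count_period, hw]
    simp only [add_comm L, hs _]
    rw [Nat.count_nth_of_infinite hinf, add_comm]
  rw [← h2]
  exact Nat.nth_count h1

lemma nth_add_mul_hammingWt (hs : Function.Periodic s L) (hL : 0 < L) (hw : hammingWt L s = w)
    (hw0 : 0 < w) (n c : ℕ) :
    Nat.nth (fun t => s t = true) (n + w * c) = Nat.nth (fun t => s t = true) n + L * c := by
  induction c with
  | zero => simp
  | succ c ih =>
    rw [mul_add, mul_one, ← add_assoc, nth_add_hammingWt hs hL hw hw0, ih]; ring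

lemma nth_lt_period (hw : hammingWt L s = w) {n : ℕ} (hn : n < w) :
    Nat.nth (fun t => s t = true) n < L :=
  Nat.nth_lt_of_lt_count (by rw [count_period, hw]; exact hn)

lemma nth_mod_period (hs : Function.Periodic s L) (hL : 0 < L) (hw : hammingWt L s = w)
    (hw0 : 0 < w) (n : ℕ) :
    Nat.nth (fun t => s t = true) n % L = Nat.nth (fun t => s t = true) (n % w) := by
  conv_lhs => rw [← Nat.mod_add_div n w]
  rw [nth_add_mul_hammingWt hs hL hw hw0, Nat.add_mul_mod_self_left,
    Nat.mod_eq_of_lt (nth_lt_period hw (Nat.mod_lt _ hw0))]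

lemma gap_mod (hs : Function.Periodic s L) (hL : 0 < L) (hw : hammingWt L s = w)
    (hw0 : 0 < w) (n : ℕ) :
    gap L w s (n % w) =
      Nat.nth (fun t => s t = true) (n + 1) - Nat.nth (fun t => s t = true) n := by
  have h1 : ∀ k < w, gap L w s k =
      Nat.nth (fun t => s t = true) (k + 1) - Nat.nth (fun t => s t = true) k := by
    intro k hk
    rw [gap]
    split_ifs with h
    · rfl
    · have hk' : k + 1 = 0 + w := by omega
      rw [hk', nth_add_hammingWt hs hL hw hw0]
  rw [h1 _ (Nat.mod_lt _ hw0)]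
  have h2 : n + 1 = n % w + 1 + w * (n / w) := by
    have := Nat.mod_add_div n w; omega
  conv_rhs => rw [h2]
  conv_rhs => rw [← Nat.mod_add_div n w]
  rw [nth_add_mul_hammingWt hs hL hw hw0]
  simp only [Nat.mod_add_div]
  have h3 : Nat.nth (fun t => s t = true) n = Nat.nth (fun t => s t = true) (n % w) + L * (n / w) := by
    conv_lhs => rw [← Nat.mod_add_div n w]
    rw [nth_add_mul_hammingWt hs hL hw hw0]
  omega

lemma zeta_gap (hs : Function.Periodic s L) (hL : 0 < L) (hw : hammingWt L s = w)
    (hw0 : 0 < w) (k j : ℕ) :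
    zeta w (gap L w s) k j =
      Nat.nth (fun t => s t = true) (k + j) - Nat.nth (fun t => s t = true) k := by
  have hm := Nat.nth_monotone (infinite_setOf_true hs hL (hw ▸ hw0))
  rw [zeta, Finset.sum_congr rfl fun i _ => gap_mod hs hL hw hw0 (k + i)]
  exact Finset.sum_range_tsub (f := fun i => Nat.nth (fun t => s t = true) (k + i))
    (fun a b h => hm (Nat.add_le_add_left h k)) j

lemma ones_eq_image (hw : hammingWt L s = w) :
    ones L s = (Finset.range w).image (Nat.nth fun t => s t = true) := by
  ext x
  rw [Finset.mem_image]
  constructor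
  · intro hx
    rw [mem_ones] at hx
    refine ⟨Nat.count (fun t => s t = true) x, ?_, Nat.nth_count hx.2⟩
    rw [Finset.mem_range, ← hw, ← count_period]
    exact Nat.count_strict_mono hx.2 hx.1
  · rintro ⟨k, hk, rfl⟩
    rw [Finset.mem_range] at hk
    refine mem_ones.2 ⟨nth_lt_period hw hk, Nat.nth_mem (p := fun t => s t = true) k fun hf => ?_⟩
    have : (ones L s) ⊆ hf.toFinset := fun x hx => by simpa using (mem_ones.1 hx).2
    have := Finset.card_le_card this
    rw [show (ones L s).card = w from hw] at this
    omega

/-- The ones of `s` among the `u` slots after `y`, as positions within one period. -/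
def windowOnes (L : ℕ) (s : ℕ → Bool) (y u : ℕ) : Finset ℕ :=
  ones L s ∩ (Finset.Icc 1 u).image fun v => (y + v) % L

lemma windowOnes_nth (hs : Function.Periodic s L) (hL : 0 < L) (hw : hammingWt L s = w)
    (hw0 : 0 < w) {k j u : ℕ}
    (h1 : Nat.nth (fun t => s t = true) (k + j) ≤ Nat.nth (fun t => s t = true) k + u)
    (h2 : Nat.nth (fun t => s t = true) k + u < Nat.nth (fun t => s t = true) (k + j + 1)) :
    windowOnes L s (Nat.nth (fun t => s t = true) k) u =
      (Finset.Ioc k (k + j)).image fun m => Nat.nth (fun t => s t = true) (m % w) := by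
  have hinf := infinite_setOf_true hs hL (hw ▸ hw0)
  ext x
  simp only [windowOnes, Finset.mem_inter, Finset.mem_image, Finset.mem_Ioc, Finset.mem_Icc,
    mem_ones]
  constructor
  · rintro ⟨⟨_, hx⟩, v, ⟨hv, hvu⟩, rfl⟩
    rw [hs.map_mod_nat] at hx
    have hc : Nat.nth (fun t => s t = true) (Nat.count (fun t => s t = true)
      (Nat.nth (fun t => s t = true) k + v)) = Nat.nth (fun t => s t = true) k + v :=
      Nat.nth_count (p := fun t => s t = true) hx
    refine ⟨Nat.count (fun t => s t = true) (Nat.nth (fun t => s t = true) k + v), ⟨?_, ?_⟩, ?_⟩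
    · rw [← Nat.nth_lt_nth hinf, hc]; omega
    · rw [← Nat.lt_succ_iff, ← Nat.nth_lt_nth hinf, hc, Nat.succ_eq_add_one]; omega
    · rw [← nth_mod_period hs hL hw hw0, hc]
  · rintro ⟨m, ⟨hkm, hmj⟩, rfl⟩
    have h3 := (Nat.nth_lt_nth hinf).2 hkm
    have h4 := (Nat.nth_le_nth hinf).2 hmj
    refine ⟨⟨nth_lt_period hw (Nat.mod_lt _ hw0), Nat.nth_mem_of_infinite hinf _⟩,
      Nat.nth (fun t => s t = true) m - Nat.nth (fun t => s t = true) k, ⟨by omega, by omega⟩, ?_⟩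
    rw [Nat.add_sub_cancel' h3.le, nth_mod_period hs hL hw hw0]

/-- The window holds the ones of index `k + 1, …, k + j`, distinct modulo `w` because `j < w`. -/
lemma card_windowOnes_nth (hs : Function.Periodic s L) (hL : 0 < L) (hw : hammingWt L s = w)
    {k j u : ℕ} (hj : j < w)
    (h1 : Nat.nth (fun t => s t = true) (k + j) ≤ Nat.nth (fun t => s t = true) k + u)
    (h2 : Nat.nth (fun t => s t = true) k + u < Nat.nth (fun t => s t = true) (k + j + 1)) :
    (windowOnes L s (Nat.nth (fun t => s t = true) k) u).card = j := by
  have hw0 : 0 < w := by omega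
  have hinf := infinite_setOf_true hs hL (hw ▸ hw0)
  rw [windowOnes_nth hs hL hw hw0 h1 h2, Finset.card_image_of_injOn, Nat.card_Ioc]
  · omega
  · intro m hm m' hm' he
    have he : m ≡ m' [MOD w] := Nat.nth_injective hinf he
    rw [Finset.mem_coe, Finset.mem_Ioc] at hm hm'
    rcases le_total m m' with h | h
    · exact Nat.ModEq.eq_of_abs_lt he (by rw [abs_lt]; omega)
    · exact Nat.ModEq.eq_of_abs_lt he (by rw [abs_lt]; omega)

end Positions

/-! ### Summation over the sets of successful ones -/

/-- Deleting `y` leaves an arbitrary `(r - 1)`-subset of `O \ W` without `y`. -/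
lemma card_powersetCard_mem_disjoint {O W : Finset ℕ} {y r : ℕ} (hy : y ∈ O) (hyW : y ∉ W)
    (hW : W ⊆ O) (hr : 1 ≤ r) :
    ((Finset.powersetCard r O).filter fun E => y ∈ E ∧ Disjoint E W).card =
      (O.card - 1 - W.card).choose (r - 1) := by
  have h1 : ((O \ W).erase y).card = O.card - 1 - W.card := by
    rw [Finset.card_erase_of_mem (Finset.mem_sdiff.2 ⟨hy, hyW⟩), Finset.card_sdiff_of_subset hW]
    omega
  rw [← h1, ← Finset.card_powersetCard]
  refine Finset.card_bij' (fun E _ => E.erase y) (fun E _ => insert y E) ?_ ?_ ?_ ?_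
  · intro E hE
    rw [Finset.mem_filter, Finset.mem_powersetCard] at hE
    obtain ⟨⟨hEO, hEr⟩, hyE, hEW⟩ := hE
    rw [Finset.mem_powersetCard, Finset.card_erase_of_mem hyE, hEr]
    exact ⟨Finset.erase_subset_erase _ (Finset.subset_sdiff.2 ⟨hEO, hEW⟩), rfl⟩
  · intro E hE
    rw [Finset.mem_powersetCard] at hE
    have h2 := (Finset.subset_erase.1 hE.1)
    have h3 := Finset.subset_sdiff.1 h2.1
    rw [Finset.mem_filter, Finset.mem_powersetCard, Finset.card_insert_of_notMem h2.2, hE.2,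
      Finset.disjoint_insert_left]
    exact ⟨⟨Finset.insert_subset hy h3.1, by omega⟩, Finset.mem_insert_self _ _, hyW, h3.2⟩
  · intro E hE
    exact Finset.insert_erase (Finset.mem_filter.1 hE).2.1
  · intro E hE
    exact Finset.erase_insert (Finset.subset_erase.1 (Finset.mem_powersetCard.1 hE).1).2

lemma sum_range_eq_sum_Ico_of_monotone {z : ℕ → ℕ} (hz : Monotone z) (h0 : z 0 = 0) (F : ℕ → ℚ)
    (n : ℕ) :
    ∑ u ∈ Finset.range (z n), F u =
      ∑ j ∈ Finset.range n, ∑ u ∈ Finset.Ico (z j) (z (j + 1)), F u := by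
  induction n with
  | zero => simp [h0]
  | succ n ih =>
    rw [Finset.sum_range_succ, ← ih, Finset.range_eq_Ico, Finset.range_eq_Ico,
      Finset.sum_Ico_consecutive _ (Nat.zero_le _) (hz n.le_succ)]

/-- Writing `d = k T + ρ` makes the floor `k` and `f(d) = ρ - 1`, and everything collapses to a
quadratic. -/
lemma F1_eq {L T : ℕ} (hT : 0 < T) (d : ℕ) : F1 L T d = (d * (d + T - 2) : ℚ) / (2 * L) := by
  have hd : (T : ℚ) * (d / T : ℕ) + (d % T : ℕ) = d := by exact_mod_cast Nat.div_add_mod d T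
  have hfl : ⌊(d : ℚ) / T⌋ = ((d / T : ℕ) : ℤ) := Rat.floor_natCast_div_natCast d T
  have hlt := Nat.mod_lt d hT
  have hTp : (0 : ℚ) < T := by positivity
  rw [F1, residF, hfl, Int.cast_natCast]
  generalize d / T = k at *
  generalize d % T = ρ at *
  -- The ceiling is `k + 1` unless `ρ = 0`, and it occurs only multiplied by `ρ`.
  have hce : (⌈(d : ℚ) / T⌉ : ℚ) * ρ = (k + 1) * ρ := by
    rcases Nat.eq_zero_or_pos ρ with h | h
    · simp [h]
    · congr 1
      have h' : (0 : ℚ) < ρ := by exact_mod_cast h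
      have hlt' : (ρ : ℚ) < T := by exact_mod_cast hlt
      have : ⌈(d : ℚ) / T⌉ = (k : ℤ) + 1 := by
        rw [Int.ceil_eq_iff, lt_div_iff₀ hTp, div_le_iff₀ hTp]
        push_cast
        constructor <;> nlinarith
      rw [this]; push_cast; rfl
  have hres : (d : ℚ) - k * T - 1 = ρ - 1 := by linarith
  rw [hres, ← sub_div, sub_add_cancel,
    show (⌈(d : ℚ) / T⌉ : ℚ) * ((ρ - 1) * ρ) = (⌈(d : ℚ) / T⌉ : ℚ) * ρ * (ρ - 1) by ring, hce, ← hd]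
  congr 1
  ring

lemma F1_eq_sum {L T : ℕ} (hT : 0 < T) (d : ℕ) :
    F1 L T d = ∑ u ∈ Finset.range d, slotAge L T u := by
  rw [F1_eq hT]
  induction d with
  | zero => simp
  | succ d ih =>
    rw [Finset.sum_range_succ, ← ih, slotAge]
    rcases eq_or_ne L 0 with rfl | hL
    · simp
    · have : (L : ℚ) ≠ 0 := by exact_mod_cast hL
      field_simp
      push_cast
      ring

/-- Exchange the sums. For `u` between `ζ(k, j)` and `ζ(k, j + 1)` the window after the `k`-th one
holds exactly `j` ones, so the number of admissible `E` is constant there and the slot ages add up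
to a difference of `F1`. -/
lemma sum_averageAge_powersetCard {L T w r : ℕ} {s : ℕ → Bool} (hs : Function.Periodic s L)
    (hL : 0 < L) (hT : 0 < T) (hw : hammingWt L s = w) (hr : 1 ≤ r) :
    ∑ E ∈ Finset.powersetCard r (ones L s), averageAge L T E =
      ∑ k ∈ Finset.range w, ∑ j ∈ Finset.range w, ((w - 1 - j).choose (r - 1) : ℚ) *
        (F1 L T (zeta w (gap L w s) k (j + 1)) - F1 L T (zeta w (gap L w s) k j)) := by
  classical
  rcases Nat.eq_zero_or_pos w with rfl | hw0
  · rw [Finset.powersetCard_eq_empty.2 (by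
      rw [show (ones L s).card = 0 from hw]; omega)]
    simp
  have hinf := infinite_setOf_true hs hL (hw ▸ hw0)
  have h1 : ∀ E ∈ Finset.powersetCard r (ones L s), averageAge L T E =
      ∑ y ∈ ones L s, ∑ u ∈ Finset.range L,
        if y ∈ E ∧ Disjoint E (windowOnes L s y u) then slotAge L T u else 0 := by
    intro E hE
    have hEO := (Finset.mem_powersetCard.1 hE).1
    rw [averageAge, ← Finset.sum_subset hEO]
    · refine Finset.sum_congr rfl fun y hy => Finset.sum_congr rfl fun u _ => if_congr ?_ rfl rfl
      rw [Finset.disjoint_left]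
      simp only [hy, true_and, windowOnes, Finset.mem_inter, Finset.mem_image, not_and, not_exists]
      exact ⟨fun h x hxE _ v hv (he : (y + v) % L = x) => h v hv (he.symm ▸ hxE), fun h v hv hE => h hE (hEO hE) v hv rfl⟩
    · intro y _ hy
      simp [hy]
  rw [Finset.sum_congr rfl h1, Finset.sum_comm, ones_eq_image hw,
    Finset.sum_image fun _ _ _ _ h => Nat.nth_injective hinf h, ← ones_eq_image hw]
  refine Finset.sum_congr rfl fun k hk => ?_
  rw [Finset.mem_range] at hk
  rw [Finset.sum_comm]
  set X := Nat.nth fun t => s t = true with hX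
  have hm : Monotone X := Nat.nth_monotone hinf
  have hz := zeta_gap hs hL hw hw0 k
  have hcount : ∀ u < L, ∀ j < w, X (k + j) ≤ X k + u → X k + u < X (k + j + 1) →
      ∑ E ∈ Finset.powersetCard r (ones L s),
        (if X k ∈ E ∧ Disjoint E (windowOnes L s (X k) u) then slotAge L T u else 0) =
      ((w - 1 - j).choose (r - 1) : ℚ) * slotAge L T u := by
    intro u hu j hj ha hb
    rw [← Finset.sum_filter, Finset.sum_const, card_powersetCard_mem_disjoint,
      card_windowOnes_nth hs hL hw hj ha hb, show (ones L s).card = w from hw, nsmul_eq_mul]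
    · rw [ones_eq_image hw]
      exact Finset.mem_image_of_mem _ (Finset.mem_range.2 hk)
    · simp only [windowOnes, Finset.mem_inter, Finset.mem_image, not_and, not_exists,
        Finset.mem_Icc, and_imp]
      intro _ v hv hvu he
      have hXk : X k % L = X k := Nat.mod_eq_of_lt (nth_lt_period hw hk)
      have : X k + v ≡ X k + 0 [MOD L] := by rw [Nat.ModEq, he, add_zero, hXk]
      have := Nat.ModEq.eq_of_lt_of_lt (Nat.ModEq.add_left_cancel' _ this) (by omega) hL
      omega
    · exact Finset.inter_subset_left
    · exact hr
  -- All `w` gaps add up to `L`, so the blocks `j < w` exhaust the delays `u < L`.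
  have hzw : zeta w (gap L w s) k w = L := by
    rw [hz, nth_add_hammingWt hs hL hw hw0]; omega
  have hzm : Monotone (zeta w (gap L w s) k) := fun a b h => by
    rw [hz, hz]; exact Nat.sub_le_sub_right (hm (Nat.add_le_add_left h k)) _
  have hsplit := sum_range_eq_sum_Ico_of_monotone hzm (by simp [zeta])
    (fun u => ∑ E ∈ Finset.powersetCard r (ones L s),
        (if X k ∈ E ∧ Disjoint E (windowOnes L s (X k) u) then slotAge L T u else 0)) w
  rw [hzw] at hsplit
  rw [hsplit]
  refine Finset.sum_congr rfl fun j hj => ?_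
  rw [Finset.mem_range] at hj
  rw [F1_eq_sum hT, F1_eq_sum hT, ← Finset.sum_Ico_eq_sub _ (hzm j.le_succ), Finset.mul_sum]
  refine Finset.sum_congr rfl fun u hu => ?_
  rw [Finset.mem_Ico, hz, hz, ← hX, Nat.succ_eq_add_one] at hu
  have hle1 := hm (show k ≤ k + j by omega)
  have hle2 := hm (show k ≤ k + (j + 1) by omega)
  have hle3 := hm (show k + (j + 1) ≤ k + w by omega)
  have hper : X (k + w) = X k + L := nth_add_hammingWt hs hL hw hw0 k
  exact hcount u (by omega) j hj (by omega) (by rw [add_assoc]; omega)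

/-- Summation by parts; Pascal's rule turns the difference of consecutive binomials into `(w - 1 -
j).choose (r - 2)`, which vanishes for `j > w + 1 - r`. -/
lemma sum_choose_mul_sub {w r : ℕ} (hr : 2 ≤ r) (H : ℕ → ℚ) (h0 : H 0 = 0) :
    ∑ j ∈ Finset.range w, ((w - 1 - j).choose (r - 1) : ℚ) * (H (j + 1) - H j) =
      ∑ j ∈ Finset.Icc 1 (w + 1 - r), ((w - j - 1).factorial * H j) /
          ((r - 2).factorial * (w - j - (r - 1)).factorial) := by
  obtain ⟨q, rfl⟩ := Nat.exists_eq_add_of_le hr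
  cases w with
  | zero => rw [Finset.Icc_eq_empty (by omega)]; simp
  | succ W =>
    have e1 : ∑ j ∈ Finset.range (W + 1), ((W + 1 - 1 - j).choose (2 + q - 1) : ℚ) * H (j + 1)
        = ∑ j ∈ Finset.range W, ((W - j).choose (q + 1) : ℚ) * H (j + 1) := by
      rw [Finset.sum_range_succ]
      simp [show 2 + q - 1 = q + 1 by omega]
    have e2 : ∑ j ∈ Finset.range (W + 1), ((W + 1 - 1 - j).choose (2 + q - 1) : ℚ) * H j
        = ∑ j ∈ Finset.range W, ((W - (j + 1)).choose (q + 1) : ℚ) * H (j + 1) := by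
      rw [Finset.sum_range_succ', h0]
      simp [show 2 + q - 1 = q + 1 by omega]
    simp only [mul_sub]
    rw [Finset.sum_sub_distrib, e1, e2, ← Finset.sum_sub_distrib]
    have e3 : Finset.Icc 1 (W + 1 + 1 - (2 + q)) = Finset.Ico 1 (W - q + 1) := by
      ext x; simp only [Finset.mem_Icc, Finset.mem_Ico]; omega
    have e4 : ∀ j ∈ Finset.range W, ((W - j).choose (q + 1) : ℚ) * H (j + 1) -
        ((W - (j + 1)).choose (q + 1) : ℚ) * H (j + 1) = (W - (j + 1)).choose q * H (j + 1) := by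
      intro j hj
      rw [Finset.mem_range] at hj
      rw [show W - j = W - (j + 1) + 1 by omega, Nat.choose_succ_succ]
      push_cast; ring
    rw [Finset.sum_congr rfl e4, e3, Finset.sum_Ico_eq_sum_range, Nat.add_sub_cancel,
      ← Finset.sum_subset (Finset.range_mono (Nat.sub_le W q))]
    · refine Finset.sum_congr rfl fun j hj => ?_
      rw [Finset.mem_range] at hj
      rw [Nat.cast_choose ℚ (show q ≤ W - (j + 1) by omega), add_comm 1 j,
        show W + 1 - (j + 1) - 1 = W - (j + 1) by omega, show 2 + q - 2 = q by omega,
        show W + 1 - (j + 1) - (2 + q - 1) = W - (j + 1) - q by omega]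
      ring
    · intro j hjW hj
      rw [Finset.mem_range] at hjW hj
      rw [Nat.choose_eq_zero_of_lt (by omega)]
      simp

/-- The empty set contributes 0. For `r = 1` all binomials are 1 and the differences telescope to
`F1 L T L` for each of the `w` ones, which gives the separate first term. -/
lemma closedForm_eq {N L w T : ℕ} {s : ℕ → Bool} (hs : Function.Periodic s L)
    (hL : 0 < L) (hT : 0 < T) (hw : hammingWt L s = w) (hw0 : 0 < w) :
    closedForm N L w T (gap L w s) = ∑ r ∈ Finset.range (w + 1), probP N L w r *
      ∑ E ∈ Finset.powersetCard r (ones L s), averageAge L T E := by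
  have hF0 : F1 L T 0 = 0 := by rw [F1_eq hT]; simp
  have hz0 : ∀ k, F1 L T (zeta w (gap L w s) k 0) = 0 := fun k => by simp [zeta, hF0]
  have hzw : ∀ k, zeta w (gap L w s) k w = L := fun k => by
    rw [zeta_gap hs hL hw hw0, nth_add_hammingWt hs hL hw hw0]; omega
  rw [closedForm, Finset.range_eq_Ico (w + 1), Finset.sum_eq_sum_Ico_succ_bot (by omega),
    Finset.sum_eq_sum_Ico_succ_bot (by omega), sum_averageAge_powersetCard hs hL hT hw le_rfl]
  have h0 : ∑ E ∈ Finset.powersetCard 0 (ones L s), averageAge L T E = 0 := by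
    simp [averageAge]
  have h1 : ∀ k, ∑ j ∈ Finset.range w, ((w - 1 - j).choose (1 - 1) : ℚ) *
      (F1 L T (zeta w (gap L w s) k (j + 1)) - F1 L T (zeta w (gap L w s) k j)) = F1 L T L := by
    intro k
    simp only [Nat.sub_self, Nat.choose_zero_right, Nat.cast_one, one_mul]
    rw [Finset.sum_range_sub fun j => F1 L T (zeta w (gap L w s) k j), hzw, hz0, sub_zero]
  have hI : Finset.Icc 2 w = Finset.Ico (0 + 1 + 1) (w + 1) := by
    ext x; simp only [Finset.mem_Icc, Finset.mem_Ico]; omega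
  rw [h0, mul_zero, zero_add, Finset.sum_congr rfl fun k _ => h1 k, Finset.sum_const,
    Finset.card_range, nsmul_eq_mul, ← mul_assoc, hI]
  congr 1
  refine Finset.sum_congr rfl fun r hr => ?_
  rw [Finset.mem_Ico] at hr
  rw [sum_averageAge_powersetCard hs hL hT hw (by omega)]
  congr 1
  rw [Finset.sum_congr rfl fun k _ => sum_choose_mul_sub (w := w) (r := r) (by omega)
    (fun j => F1 L T (zeta w (gap L w s) k j)) (hz0 k), Finset.sum_comm]
  refine Finset.sum_congr rfl fun j _ => ?_
  rw [Finset.mul_sum, Finset.sum_div]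

/-- Offsets are grouped by their successful set, whose probability depends on its size only. -/
lemma sum_averageAge_successfulOnes {N L T w : ℕ} {s : Fin N → ℕ → Bool} (h : IsMHUI N L s)
    (hw : ∀ j, hammingWt L (s j) = w) (hL : 0 < L) (hT : 0 < T) (i : Fin N) :
    (∑ τ : Fin N → Fin L, averageAge L T (successfulOnes s τ i)) / (L : ℚ) ^ N =
      closedForm N L w T (gap L w (s i)) := by
  classical
  have hw0 : 0 < w := by
    have h1 := h.le_weight i
    have h2 := i.pos
    rw [hw] at h1; omega
  have hmaps : ∀ τ ∈ (Finset.univ : Finset (Fin N → Fin L)),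
      successfulOnes s τ i ∈ (ones L (s i)).powerset := fun τ _ =>
    Finset.mem_powerset.2 (successfulOnes_subset s τ i)
  rw [closedForm_eq (h.periodic i) hL hT (hw i) hw0, ← Finset.sum_fiberwise_of_maps_to hmaps,
    Finset.sum_div, Finset.sum_powerset, show (ones L (s i)).card = w from hw i]
  refine Finset.sum_congr rfl fun r _ => ?_
  rw [Finset.mul_sum]
  refine Finset.sum_congr rfl fun E hE => ?_
  obtain ⟨hEO, hEr⟩ := Finset.mem_powersetCard.1 hE
  rw [← hEr, ← eventProb_eq_probP h hw hL i hEO, eventProb, div_mul_eq_mul_div]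
  congr 1
  rw [Finset.sum_congr rfl (g := fun _ => averageAge L T E) fun τ hτ => by
    rw [(Finset.mem_filter.1 hτ).2], Finset.sum_const, nsmul_eq_mul]

/-! ### Assembly of the three claims -/

theorem theorem3 :
    -- the closed form, for every MHUI set with identical Hamming weight
    (∀ (N L w T : ℕ) (s : Fin N → ℕ → Bool), IsMHUI N L s → (∀ j, hammingWt L (s j) = w) →
      0 < T → Nat.gcd T L = 1 → ∀ i : Fin N,
        (∀ r ∈ Finset.Icc 1 w, ∀ E ⊆ ones L (s i), E.card = r →
          eventProb L s i E = probP N L w r) ∧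
        ∃ A : (Fin N → Fin L) → ℝ,
          (∀ (τ : Fin N → Fin L) (a₀ : ℕ), IsAverageAoI T s τ i a₀ (A τ)) ∧
          (∑ τ, A τ) / (L : ℝ) ^ N = (closedForm N L w T (gap L w (s i)) : ℝ)) ∧
    -- any `N` of the CRT-constructed sequences form such a set
    (∀ (N p q : ℕ) (g : Fin N → ℕ), 1 ≤ N → IsLeastPrimeGE N p → Nat.Coprime q p →
      2 * p - 1 ≤ q → Function.Injective g → (∀ j, g j ∈ Finset.Icc 1 (p + 1)) →
        IsMHUI N (p * q) (fun j => crtSeq p q (g j)) ∧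
        ∀ j, hammingWt (p * q) (crtSeq p q (g j)) = p) ∧
    -- the closed form is evaluated by one program in `O(w ^ 4)` steps, which is `O(N ^ 4)` steps
    -- under the CRT construction
    (∃ (e : Prog) (C : ℕ),
      (∀ (N L w T : ℕ) (l : ℕ → ℕ), 1 ≤ N → N ≤ w →
        e.eval l (inputs N L w T) = closedForm N L w T l ∧
        e.cost l (inputs N L w T) ≤ C * w ^ 4) ∧
      (∀ (N p L T : ℕ) (l : ℕ → ℕ), 1 ≤ N → IsLeastPrimeGE N p →
        e.cost l (inputs N L p T) ≤ C * N ^ 4)) := by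
  refine ⟨fun N L w T s hs hw hT hTL i => ?_, fun N p q g _ hp hpq hq hinj hg =>
    isMHUI_crtSeq hp hpq hq hinj hg, exists_closedForm_program⟩
  have hL : 0 < L := by
    rcases Nat.eq_zero_or_pos L with rfl | hL
    · have h1 := hs.le_weight i
      have h2 := i.pos
      simp [hammingWt, ones] at h1
      omega
    · exact hL
  refine ⟨fun r _ E hE hEr => hEr ▸ eventProb_eq_probP hs hw hL i hE,
    fun τ => (averageAge L T (successfulOnes s τ i) : ℚ),
    fun τ a₀ => isAverageAoI_averageAge hs hL hT hTL τ i a₀, ?_⟩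
  rw [← sum_averageAge_successfulOnes hs hw hL hT i]
  push_cast
  rfl
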